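/- Let $(X,\mathsf d,\mathfrak m)$ be a metric measure space: $(X,\mathsf d)$ is a complete separable metric space and $\mathfrak m\neq 0$ is a non-negative Borel measure on $X$, finite on balls. Let $p\in(1,\infty)$. A $D$-structure assigns to every $u\in L^p_{loc}(\mathfrak m)$ (i.e. $u$ is $p$-integrable on every bounded Borel set) a family $D[u]$ of Borel functions $X\to[0,\infty]$ (up to $\mathfrak m$-a.e. equality), such that: (A1) $\mathrm{Lip}(u)\,\chi_{\{u>0\}}\in D[u]$ for every Lipschitz $0\le u\in L^p_{loc}(\mathfrak m)$; (A2) if $g_i\in D[u_i]$, $\alpha_i\in\mathbb R$ $(i=1,2)$ and $g\ge|\alpha_1|g_1+|\alpha_2|g_2$ $\mathfrak m$-a.e., then $g\in D[\alpha_1u_1+\alpha_2u_2]$; (A3) if $g\in D[u]$ and $\varphi:X\to\mathbb R$ is bounded and Lipschitz, then $g\sup_X|\varphi|+\mathrm{Lip}(\varphi)|u|\in D[\varphi u]$; (A4) if $g_i\in D[u_i]$, then $\max\{g_1,g_2\}\in D[\max\{u_1,u_2\}]\cap D[\min\{u_1,u_2\}]$; (A5) if $g_n\in D[u_n]\cap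 L^p(\mathfrak m)$, $u_n\to u$ in $L^p_{loc}(\mathfrak m)$ and $g_n\to g$ in $L^p(\mathfrak m)$, then $g\in D[u]$. For $B\subseteq X$ Borel put $\mathcal E_p(u|B)=\inf\{\int_B g^p\,d\mathfrak m: g\in D[u]\}$ and let $S^p(X)=\{u\in L^p_{loc}(\mathfrak m):\mathcal E_p(u|X)<\infty\}$. For $u\in S^p(X)$ the minimal pseudo-gradient $\underline Du$ is the unique $g\in D[u]$ with $\int_X g^p\,d\mathfrak m=\mathcal E_p(u|X)$. Assume that the $D$-structure is pointwise local: for every $u\in S^p(X)$, $\mathcal E_p(u|B)=0$ whenever $u$ is $\mathfrak m$-a.e. constant on the Borel set $B$, and $\underline Du\le g$ $\mathfrak m$-a.e. for every $g\in D[u]$. An $L^p(\mathfrak m)$-normed $L^\infty(\mathfrak m)$-module is a real Banach space $\mathscr M$ that is a module over the ring $L^\infty(\mathfrak m)$ (constants acting as real scalars), with a map $|\cdot|$ from $\mathscr M$ to the non-negative functions of $L^p(\mathfrak m)$ such that $|fv|=|f||v|$ $\mathfrak m$-a.e. and $\|v\|_{\mathscr M}=\||v|\|_{L^p(\mathfrak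 m)}$. Let $L^p(T^*X;D)$ be the cotangent module and $d:S^p(X)\to L^p(T^*X;D)$ the differential, i.e. the couple, unique up to unique isomorphism, of an $L^p(\mathfrak m)$-normed $L^\infty(\mathfrak m)$-module and a linear map such that $|du|=\underline Du$ $\mathfrak m$-a.e. for all $u\in S^p(X)$ and the elements $\sum_{i=1}^n\chi_{B_i}\,du_i$, with $(B_i)_i$ a finite Borel partition of $X$ and $u_i\in S^p(X)$, are dense. **Proposition 3.4 (Calculus rules for $du$).** The following hold. 1. If $u\in S^p(X)$ and $N\subseteq\mathbb R$ is a Borel set of Lebesgue measure zero, then $\chi_{u^{-1}(N)}\,du=0$. 2. (Chain rule) If $u\in S^p(X)$ and $\varphi:\mathbb R\to\mathbb R$ is Lipschitz, then $\varphi\circ u\in S^p(X)$ and $d(\varphi\circ u)=(\varphi'\circ u)\,du$. Here $\varphi'\circ u$ denotes any $f\in L^\infty(\mathfrak m)$ (one exists) with $f(x)=\varphi'(u(x))$ for $\mathfrak m$-a.e. $x$ such that $\varphi$ is differentiable at $u(x)$. 3. (Leibniz rule) If $u,v\in S^p(X)\cap L^\infty(\mathfrak m)$, then $uv\in S^p(X)\cap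 L^\infty(\mathfrak m)$ and $d(uv)=u\,dv+v\,du$. -/

import Mathlib

open MeasureTheory Filter Topology Set
open scoped ENNReal NNReal

namespace AxiomaticSobolev

/-! ### Functions and D-structures -/

section Basic

variable {X : Type*} [MetricSpace X] [MeasurableSpace X]

/-- The space `L^p_loc(m)`: classes `u` of measurable functions `X → ℝ` whose restriction to every
bounded Borel set is `p`-integrable. -/
def LpLoc (p : ℝ≥0∞) (m : Measure X) : Submodule ℝ (X →ₘ[m] ℝ) where
  carrier := {u | ∀ B : Set X, Bornology.IsBounded B → MeasurableSet B → MemLp u p (m.restrict B)}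
  zero_mem' := by
    intro B _ _
    exact (memLp_congr_ae (ae_restrict_of_ae AEEqFun.coeFn_zero)).2 MemLp.zero
  add_mem' := by
    intro u v hu hv B hB hB'
    exact (memLp_congr_ae (ae_restrict_of_ae (AEEqFun.coeFn_add u v))).2
      ((hu B hB hB').add (hv B hB hB'))
  smul_mem' := by
    intro c u hu B hB hB'
    exact (memLp_congr_ae (ae_restrict_of_ae (AEEqFun.coeFn_smul c u))).2
      ((hu B hB hB').const_smul c)

/-- A `D`-structure with exponent `p` on `(X, d, m)`: every `u ∈ L^p_loc(m)` is given a family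
`D[u]` of classes of measurable functions `X → [0, ∞]`, the pseudo-gradients of `u`, subject to five
axioms, where `1 ≤ p < ∞`. (The values of `grad` outside `L^p_loc(m)` play no role anywhere.)

In `nontrivial` and `leibniz`, `K` ranges over all the Lipschitz constants of the given Lipschitz
function and `C` over all its bounds; by `upper_linear`, which makes `D[u]` upward closed, this is
the same as taking the least ones. -/
structure DStructure (p : ℝ≥0∞) (m : Measure X) where
  one_le : 1 ≤ p
  ne_top : p ≠ ∞
  /-- the family `D[u]` of pseudo-gradients of `u` -/
  grad : (X →ₘ[m] ℝ) → Set (X →ₘ[m] ℝ≥0∞)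
  /-- `Lip(u) χ_{u > 0} ∈ D[u]` for nonnegative Lipschitz `u ∈ L^p_loc` -/
  nontrivial : ∀ u ∈ LpLoc p m, ∀ (f : X → ℝ) (K : ℝ≥0), LipschitzWith K f → (∀ x, 0 ≤ f x) →
    u =ᵐ[m] f → ∀ g : X →ₘ[m] ℝ≥0∞, g =ᵐ[m] {x | 0 < f x}.indicator (fun _ => (K : ℝ≥0∞)) →
    g ∈ grad u
  /-- upper linearity -/
  upper_linear : ∀ u₁ ∈ LpLoc p m, ∀ u₂ ∈ LpLoc p m, ∀ g₁ ∈ grad u₁, ∀ g₂ ∈ grad u₂,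
    ∀ (α₁ α₂ : ℝ) (g : X →ₘ[m] ℝ≥0∞),
    (∀ᵐ x ∂m, ‖α₁‖ₑ * g₁ x + ‖α₂‖ₑ * g₂ x ≤ g x) → g ∈ grad (α₁ • u₁ + α₂ • u₂)
  /-- Leibniz rule: `g sup|φ| + Lip(φ) |u| ∈ D[φ u]` for bounded Lipschitz `φ` and `g ∈ D[u]` -/
  leibniz : ∀ u ∈ LpLoc p m, ∀ g ∈ grad u, ∀ (φ : X → ℝ) (K C : ℝ≥0), LipschitzWith K φ →
    (∀ x, |φ x| ≤ C) → ∀ w : X →ₘ[m] ℝ, w =ᵐ[m] (fun x => φ x * u x) →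
    ∀ h : X →ₘ[m] ℝ≥0∞, h =ᵐ[m] (fun x => g x * C + K * ‖u x‖ₑ) → h ∈ grad w
  /-- lattice property -/
  lattice : ∀ u₁ ∈ LpLoc p m, ∀ u₂ ∈ LpLoc p m, ∀ g₁ ∈ grad u₁, ∀ g₂ ∈ grad u₂,
    g₁ ⊔ g₂ ∈ grad (u₁ ⊔ u₂) ∩ grad (u₁ ⊓ u₂)
  /-- completeness: if `u_n → u` in `L^p_loc` and `D[u_n] ∋ g_n → g` in `L^p` then `g ∈ D[u]` -/
  complete : ∀ (u : ℕ → X →ₘ[m] ℝ) (g : ℕ → X →ₘ[m] ℝ≥0∞), (∀ n, u n ∈ LpLoc p m) →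
    (∀ n, eLpNorm (g n) p m < ∞) → (∀ n, g n ∈ grad (u n)) →
    ∀ u' ∈ LpLoc p m, ∀ g' : X →ₘ[m] ℝ≥0∞, eLpNorm g' p m < ∞ →
    (∀ B : Set X, Bornology.IsBounded B → MeasurableSet B →
      Tendsto (fun n => eLpNorm (fun x => u n x - u' x) p (m.restrict B)) atTop (𝓝 0)) →
    Tendsto (fun n => eLpNorm (fun x => (g n x).toReal - (g' x).toReal) p m) atTop (𝓝 0) →
    g' ∈ grad u'

namespace DStructure

variable {p : ℝ≥0∞} {m : Measure X} (D : DStructure p m)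

/-- The `p`-Dirichlet energy `E_p(u | B) = inf { ∫_B g^p dm : g ∈ D[u] }`. -/
noncomputable def energy (u : X →ₘ[m] ℝ) (B : Set X) : ℝ≥0∞ :=
  ⨅ g ∈ D.grad u, ∫⁻ x in B, (g x) ^ p.toReal ∂m

theorem energy_univ_lt_top {u : X →ₘ[m] ℝ} :
    D.energy u univ < ∞ ↔ ∃ g ∈ D.grad u, ∫⁻ x, (g x) ^ p.toReal ∂m < ∞ := by
  simp [energy, iInf_lt_iff]

theorem zero_mem_grad_zero : (0 : X →ₘ[m] ℝ≥0∞) ∈ D.grad 0 := by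
  refine D.nontrivial 0 (Submodule.zero_mem _) 0 0 (LipschitzWith.const 0) (fun _ => le_rfl)
    AEEqFun.coeFn_zero 0 ?_
  filter_upwards [AEEqFun.coeFn_zero (α := X) (μ := m) (β := ℝ≥0∞)] with x hx
  simp [hx]

theorem toReal_pos (D' : DStructure p m) : 0 < p.toReal :=
  ENNReal.toReal_pos (zero_lt_one.trans_le D'.one_le).ne' D'.ne_top

theorem one_le_toReal (D' : DStructure p m) : 1 ≤ p.toReal := by
  simpa using ENNReal.toReal_mono D'.ne_top D'.one_le

/-- The Sobolev class `S^p(X)`: all `u ∈ L^p_loc(m)` with `E_p(u) < ∞`; it is a vector space. -/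
def sobolevClass : Submodule ℝ (X →ₘ[m] ℝ) where
  carrier := {u | u ∈ LpLoc p m ∧ D.energy u univ < ∞}
  zero_mem' := by
    refine ⟨Submodule.zero_mem _, D.energy_univ_lt_top.2 ?_⟩
    refine ⟨0, D.zero_mem_grad_zero, ?_⟩
    have : ∫⁻ x, ((0 : X →ₘ[m] ℝ≥0∞) x) ^ p.toReal ∂m = ∫⁻ _, 0 ∂m := by
      refine lintegral_congr_ae ?_
      filter_upwards [AEEqFun.coeFn_zero (α := X) (μ := m) (β := ℝ≥0∞)] with x hx
      simp [hx, D.toReal_pos]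
    simp [this]
  add_mem' := by
    rintro u v ⟨hu, hu'⟩ ⟨hv, hv'⟩
    obtain ⟨g, hg, hgi⟩ := D.energy_univ_lt_top.1 hu'
    obtain ⟨h, hh, hhi⟩ := D.energy_univ_lt_top.1 hv'
    refine ⟨add_mem hu hv, D.energy_univ_lt_top.2 ⟨g + h, ?_, ?_⟩⟩
    · have := D.upper_linear u hu v hv g hg h hh 1 1 (g + h) (by
        filter_upwards [AEEqFun.coeFn_add g h] with x hx
        simp [hx])
      simpa using this
    · have : ∫⁻ x, ((g + h : X →ₘ[m] ℝ≥0∞) x) ^ p.toReal ∂m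
          = ∫⁻ x, ((g : X → ℝ≥0∞) + h) x ^ p.toReal ∂m := by
        refine lintegral_congr_ae ?_
        filter_upwards [AEEqFun.coeFn_add g h] with x hx
        simp [hx]
      rw [this]
      exact ENNReal.lintegral_rpow_add_lt_top_of_lintegral_rpow_lt_top g.measurable.aemeasurable
        hgi hhi D.one_le_toReal
  smul_mem' := by
    rintro c u ⟨hu, hu'⟩
    obtain ⟨g, hg, hgi⟩ := D.energy_univ_lt_top.1 hu'
    have hm : Measurable fun x => ‖c‖ₑ * g x := g.measurable.const_mul _
    refine ⟨Submodule.smul_mem _ c hu, D.energy_univ_lt_top.2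
      ⟨AEEqFun.mk _ hm.aestronglyMeasurable, ?_, ?_⟩⟩
    · have := D.upper_linear u hu u hu g hg g hg c 0 (AEEqFun.mk _ hm.aestronglyMeasurable) (by
        filter_upwards [AEEqFun.coeFn_mk _ hm.aestronglyMeasurable (μ := m)] with x hx
        simp [hx])
      simpa using this
    · have : ∫⁻ x, (AEEqFun.mk _ hm.aestronglyMeasurable : X →ₘ[m] ℝ≥0∞) x ^ p.toReal ∂m
          = ∫⁻ x, ‖c‖ₑ ^ p.toReal * (g x) ^ p.toReal ∂m := by
        refine lintegral_congr_ae ?_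
        filter_upwards [AEEqFun.coeFn_mk _ hm.aestronglyMeasurable (μ := m)] with x hx
        rw [hx, ENNReal.mul_rpow_of_nonneg _ _ D.toReal_pos.le]
      rw [this, lintegral_const_mul _ (g.measurable.pow_const _)]
      exact ENNReal.mul_lt_top (ENNReal.rpow_lt_top_of_nonneg D.toReal_pos.le (by simp)) hgi

/-- The minimal pseudo-gradient of `u`: the element `g` of `D[u]` with `∫ g^p dm = E_p(u)`, which
exists and is unique if `1 < p` and `u ∈ S^p(X)` (and zero, by convention, where there is none). -/
noncomputable def minimalGrad (u : X →ₘ[m] ℝ) : X →ₘ[m] ℝ≥0∞ :=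
  open Classical in
  if h : ∃ g ∈ D.grad u, ∫⁻ x, (g x) ^ p.toReal ∂m = D.energy u univ then h.choose else 0

/-- `D` is pointwise local: it has the properties
* (L1) if `u ∈ S^p(X)` is a.e. constant on a Borel set `B`, then `E_p(u | B) = 0`;
* (L5) if `u ∈ S^p(X)`, then the minimal pseudo-gradient of `u` is a.e. below every `g ∈ D[u]`. -/
structure IsPointwiseLocal : Prop where
  energy_eq_zero : ∀ u ∈ D.sobolevClass, ∀ (B : Set X) (c : ℝ), MeasurableSet B →
    (∀ᵐ x ∂m, x ∈ B → u x = c) → D.energy u B = 0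
  minimalGrad_le : ∀ u ∈ D.sobolevClass, ∀ g ∈ D.grad u, ∀ᵐ x ∂m, D.minimalGrad u x ≤ g x

end DStructure
end Basic

/-! ### Existence and uniqueness of the minimal pseudo-gradient -/

theorem rpow_midpoint_gap {q : ℝ} (hq : 1 < q) {ε : ℝ} (hε : 0 < ε) :
    ∃ C, 0 ≤ C ∧ ∀ a b : ℝ, 0 ≤ a → 0 ≤ b →
      |a - b| ^ q ≤ ε * (a ^ q + b ^ q) + C * ((a ^ q + b ^ q) / 2 - ((a + b) / 2) ^ q) := by
  have q0 : 0 < q := by linarith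
  let ψ : ℝ → ℝ := fun t => (1 + t ^ q) / 2 - ((1 + t) / 2) ^ q
  have hψc : Continuous ψ := by
    have := Real.continuous_rpow_const (q := q) q0.le
    fun_prop (disch := assumption)
  have hψ0 : ∀ t, 0 ≤ t → 0 ≤ ψ t := by
    intro t ht
    have := (convexOn_rpow hq.le).2 (show (1:ℝ) ∈ Ici 0 by simp) (show t ∈ Ici 0 from ht)
      (show (0:ℝ) ≤ 1/2 by norm_num) (show (0:ℝ) ≤ 1/2 by norm_num) (by norm_num)
    simp only [smul_eq_mul, Real.one_rpow] at this
    rw [show (1/2 : ℝ) * 1 + 1/2 * t = (1 + t)/2 by ring] at this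
    simp only [ψ]; linarith
  have hψ1 : ∀ t, 0 ≤ t → t ≠ 1 → 0 < ψ t := by
    intro t ht ht1
    have := (strictConvexOn_rpow hq).2 (show (1:ℝ) ∈ Ici 0 by simp) (show t ∈ Ici 0 from ht)
      ht1.symm (show (0:ℝ) < 1/2 by norm_num) (show (0:ℝ) < 1/2 by norm_num) (by norm_num)
    simp only [smul_eq_mul, Real.one_rpow] at this
    rw [show (1/2 : ℝ) * 1 + 1/2 * t = (1 + t)/2 by ring] at this
    simp only [ψ]; linarith
  have key : ∃ C, 0 ≤ C ∧ ∀ t, 0 ≤ t → t ≤ 1 → (1 - t) ^ q ≤ ε * (1 + t ^ q) + C * ψ t := by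
    have hc : Continuous fun t : ℝ => (1 - t) ^ q :=
      (Real.continuous_rpow_const q0.le).comp (continuous_const.sub continuous_id)
    have hK : IsCompact (Icc (0:ℝ) 1 ∩ {t | ε ≤ (1 - t) ^ q}) :=
      isCompact_Icc.inter_right (isClosed_le continuous_const hc)
    rcases (Icc (0:ℝ) 1 ∩ {t | ε ≤ (1 - t) ^ q}).eq_empty_or_nonempty with he | hne
    · refine ⟨0, le_rfl, fun t h0 h1 => ?_⟩
      have : t ∉ Icc (0:ℝ) 1 ∩ {t | ε ≤ (1 - t) ^ q} := by simp [he]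
      have h2 : (1 - t) ^ q < ε := by
        by_contra h; exact this ⟨⟨h0, h1⟩, not_lt.1 h⟩
      have : 0 ≤ t ^ q := Real.rpow_nonneg h0 _
      nlinarith
    · obtain ⟨s, ⟨⟨hs0, hs1⟩, hs2⟩, hmin⟩ := hK.exists_isMinOn hne hψc.continuousOn
      have hs : s ≠ 1 := by
        rintro rfl
        simp only [mem_ofPred_eq, sub_self, Real.zero_rpow q0.ne'] at hs2
        linarith
      have hpos := hψ1 s hs0 hs
      refine ⟨(ψ s)⁻¹, by positivity, fun t h0 h1 => ?_⟩
      have htq : 0 ≤ t ^ q := Real.rpow_nonneg h0 _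
      by_cases h : ε ≤ (1 - t) ^ q
      · have h3 : ψ s ≤ ψ t := hmin ⟨⟨h0, h1⟩, h⟩
        have h4 : (1 - t) ^ q ≤ 1 := Real.rpow_le_one (by linarith) (by linarith) q0.le
        have h5 : 1 ≤ (ψ s)⁻¹ * ψ t := by
          rw [inv_mul_eq_div, one_le_div hpos]; exact h3
        have : 0 ≤ ε * (1 + t ^ q) := by positivity
        linarith
      · push Not at h
        have : 0 ≤ (ψ s)⁻¹ * ψ t := mul_nonneg (by positivity) (hψ0 t h0)
        nlinarith
  obtain ⟨C, hC, hkey⟩ := key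
  have main : ∀ a b : ℝ, 0 ≤ b → b ≤ a →
      |a - b| ^ q ≤ ε * (a ^ q + b ^ q) + C * ((a ^ q + b ^ q) / 2 - ((a + b) / 2) ^ q) := by
    intro a b hb hab
    rcases hb.trans hab |>.eq_or_lt with h0 | hpos
    · subst h0
      obtain rfl : b = 0 := le_antisymm hab hb
      simp [Real.zero_rpow q0.ne']
    · have ht0 : 0 ≤ b / a := by positivity
      have ht1 : b / a ≤ 1 := (div_le_one hpos).2 hab
      have h := hkey (b / a) ht0 ht1
      have e1 : |a - b| ^ q = a ^ q * (1 - b / a) ^ q := by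
        rw [← Real.mul_rpow hpos.le (by linarith), abs_of_nonneg (by linarith)]
        congr 1; field_simp
      have e2 : b ^ q = a ^ q * (b / a) ^ q := by
        rw [← Real.mul_rpow hpos.le ht0]; congr 1; field_simp
      have e3 : ((a + b) / 2) ^ q = a ^ q * ((1 + b / a) / 2) ^ q := by
        rw [← Real.mul_rpow hpos.le (by positivity)]; congr 1; field_simp
      rw [e1, e3, e2]
      have hq' : 0 ≤ a ^ q := Real.rpow_nonneg hpos.le _
      have := mul_le_mul_of_nonneg_left h hq'
      simp only [ψ] at this
      linarith
  refine ⟨C, hC, fun a b ha hb => ?_⟩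
  rcases le_total b a with h | h
  · exact main a b hb h
  · have := main b a ha h
    rw [abs_sub_comm, add_comm (a ^ q), add_comm a b]; exact this

theorem Lp_norm_rpow {X : Type*} [MeasurableSpace X] {m : Measure X} {p : ℝ≥0∞}
    (h0 : p ≠ 0) (ht : p ≠ ∞) (f : Lp ℝ p m) : ‖f‖ ^ p.toReal = ∫ x, |f x| ^ p.toReal ∂m := by
  have hp := ENNReal.toReal_pos h0 ht
  rw [Lp.norm_def, (Lp.memLp f).eLpNorm_eq_integral_rpow_norm h0 ht,
    ENNReal.toReal_ofReal (Real.rpow_nonneg (by positivity) _), ← Real.rpow_mul (by positivity),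
    inv_mul_cancel₀ hp.ne', Real.rpow_one]
  rfl

theorem Lp_norm_sub_rpow_le {X : Type*} [MeasurableSpace X] {m : Measure X} {p : ℝ≥0∞}
    [Fact (1 ≤ p)] (hp : 1 < p) (ht : p ≠ ∞) {ε : ℝ} (hε : 0 < ε) :
    ∃ C, 0 ≤ C ∧ ∀ f g : Lp ℝ p m, (0 : X → ℝ) ≤ᵐ[m] f → (0 : X → ℝ) ≤ᵐ[m] g →
      ‖f - g‖ ^ p.toReal ≤ ε * (‖f‖ ^ p.toReal + ‖g‖ ^ p.toReal) +
        C * ((‖f‖ ^ p.toReal + ‖g‖ ^ p.toReal) / 2 - ‖(1/2 : ℝ) • (f + g)‖ ^ p.toReal) := by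
  have h0 : p ≠ 0 := (zero_lt_one.trans hp).ne'
  have hq : 1 < p.toReal := by simpa using (ENNReal.toReal_lt_toReal (by simp) ht).2 hp
  obtain ⟨C, hC, h⟩ := rpow_midpoint_gap hq hε
  refine ⟨C, hC, fun f g hf hg => ?_⟩
  have I : ∀ w : Lp ℝ p m, Integrable (fun x => |w x| ^ p.toReal) m := fun w =>
    (Lp.memLp w).integrable_norm_rpow h0 ht
  simp only [Lp_norm_rpow h0 ht]
  have J1 : Integrable (fun x => ε * (|f x| ^ p.toReal + |g x| ^ p.toReal)) m :=
    ((I f).add (I g)).const_mul ε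
  have J2 : Integrable (fun x => (|f x| ^ p.toReal + |g x| ^ p.toReal) / 2) m :=
    ((I f).add (I g)).div_const 2
  have J3 : Integrable (fun x => C * ((|f x| ^ p.toReal + |g x| ^ p.toReal) / 2
      - |((1/2 : ℝ) • (f + g)) x| ^ p.toReal)) m :=
    (J2.sub (I ((1/2 : ℝ) • (f + g)))).const_mul C
  have e : ∫ x, (ε * (|f x| ^ p.toReal + |g x| ^ p.toReal) +
      C * ((|f x| ^ p.toReal + |g x| ^ p.toReal) / 2 - |((1/2 : ℝ) • (f + g)) x| ^ p.toReal)) ∂m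
      = ε * (∫ x, |f x| ^ p.toReal ∂m + ∫ x, |g x| ^ p.toReal ∂m) +
        C * ((∫ x, |f x| ^ p.toReal ∂m + ∫ x, |g x| ^ p.toReal ∂m) / 2
          - ∫ x, |((1/2 : ℝ) • (f + g)) x| ^ p.toReal ∂m) := by
    rw [integral_add J1 J3, integral_const_mul, integral_const_mul, integral_sub J2 (I _),
      integral_div, integral_add (I f) (I g)]
  rw [← e]
  refine integral_mono_ae (I _) (J1.add J3) ?_
  filter_upwards [hf, hg, Lp.coeFn_sub f g, Lp.coeFn_smul (1/2 : ℝ) (f + g), Lp.coeFn_add f g]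
    with x h1 h2 h3 h4 h5
  simp only [Pi.zero_apply] at h1 h2
  have := h (f x) (g x) h1 h2
  simp only [h3, h4, h5, Pi.sub_apply, Pi.smul_apply, Pi.add_apply, smul_eq_mul]
  rw [abs_of_nonneg h1, abs_of_nonneg h2, abs_of_nonneg (by positivity : 0 ≤ 1/2 * (f x + g x)),
    show 1/2 * (f x + g x) = (f x + g x) / 2 by ring]
  exact this

theorem Lp_existsUnique_min {X : Type*} [MeasurableSpace X] {m : Measure X} {p : ℝ≥0∞}
    [Fact (1 ≤ p)] (hp : 1 < p) (ht : p ≠ ∞) (K : Set (Lp ℝ p m)) (hne : K.Nonempty)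
    (hpos : ∀ f ∈ K, (0 : X → ℝ) ≤ᵐ[m] f) (hmid : ∀ f ∈ K, ∀ g ∈ K, (1/2 : ℝ) • (f + g) ∈ K)
    (hcl : IsClosed K) : ∃! f, f ∈ K ∧ ∀ g ∈ K, ‖f‖ ≤ ‖g‖ := by
  have h0 : p ≠ 0 := (zero_lt_one.trans hp).ne'
  have hq : 1 < p.toReal := by simpa using (ENNReal.toReal_lt_toReal (by simp) ht).2 hp
  have q0 : 0 < p.toReal := by linarith
  set r := sInf (norm '' K) with hr
  have hbdd : BddBelow (norm '' K) := ⟨0, by rintro _ ⟨f, _, rfl⟩; positivity⟩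
  have hrle : ∀ f ∈ K, r ≤ ‖f‖ := fun f hf => csInf_le hbdd ⟨f, hf, rfl⟩
  have hr0 : 0 ≤ r := le_csInf (hne.image _) (by rintro _ ⟨f, _, rfl⟩; positivity)
  -- nearly minimal elements are close to each other
  have close : ∀ η : ℝ, 0 < η → ∃ δ, 0 < δ ∧ ∀ f ∈ K, ∀ g ∈ K, ‖f‖ ^ p.toReal ≤ r ^ p.toReal + δ →
      ‖g‖ ^ p.toReal ≤ r ^ p.toReal + δ → ‖f - g‖ < η := by
    intro η hη
    have hrq : 0 ≤ r ^ p.toReal := Real.rpow_nonneg hr0 _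
    have hηq : 0 < η ^ p.toReal := Real.rpow_pos_of_pos hη _
    obtain ⟨C, hC, h⟩ := Lp_norm_sub_rpow_le (m := m) hp ht
      (ε := η ^ p.toReal / (4 * (r ^ p.toReal + 1))) (by positivity)
    refine ⟨min 1 (η ^ p.toReal / (4 * (C + 1))), by positivity, fun f hf g hg h1 h2 => ?_⟩
    set δ := min 1 (η ^ p.toReal / (4 * (C + 1)))
    have hδ1 : δ ≤ 1 := min_le_left _ _
    have hδ0 : 0 < δ := by positivity
    have hδ2 : C * δ ≤ η ^ p.toReal / 4 := by
      have : δ ≤ η ^ p.toReal / (4 * (C + 1)) := min_le_right _ _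
      rw [le_div_iff₀ (by positivity)] at this
      nlinarith
    have h3 := h f g (hpos f hf) (hpos g hg)
    have h4 : r ^ p.toReal ≤ ‖(1/2 : ℝ) • (f + g)‖ ^ p.toReal :=
      Real.rpow_le_rpow hr0 (hrle _ (hmid f hf g hg)) q0.le
    have h5 : η ^ p.toReal / (4 * (r ^ p.toReal + 1)) * (‖f‖ ^ p.toReal + ‖g‖ ^ p.toReal)
        ≤ η ^ p.toReal / 2 := by
      calc _ ≤ η ^ p.toReal / (4 * (r ^ p.toReal + 1)) * (2 * (r ^ p.toReal + 1)) := by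
            gcongr; linarith
        _ = _ := by field_simp; norm_num
    have h6 : C * ((‖f‖ ^ p.toReal + ‖g‖ ^ p.toReal) / 2 - ‖(1/2 : ℝ) • (f + g)‖ ^ p.toReal)
        ≤ C * δ := by
      gcongr; linarith
    have h7 : ‖f - g‖ ^ p.toReal < η ^ p.toReal := by linarith
    exact lt_of_not_ge fun hh => absurd (Real.rpow_le_rpow hη.le hh q0.le) (not_le.2 h7)
  have hcont : Continuous fun t : ℝ => t ^ p.toReal := Real.continuous_rpow_const q0.le
  obtain ⟨a, -, ha, haK⟩ := exists_seq_tendsto_sInf (hne.image norm) hbdd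
  choose f hfK hfa using haK
  have hlim : Tendsto (fun n => ‖f n‖) atTop (𝓝 r) := by simpa [hfa] using ha
  have hlimq : Tendsto (fun n => ‖f n‖ ^ p.toReal) atTop (𝓝 (r ^ p.toReal)) :=
    (hcont.tendsto _).comp hlim
  have hcauchy : CauchySeq f := by
    rw [Metric.cauchySeq_iff]
    intro η hη
    obtain ⟨δ, hδ, h⟩ := close η hη
    have := hlimq.eventually (gt_mem_nhds (show r ^ p.toReal < r ^ p.toReal + δ by linarith))
    obtain ⟨N, hN⟩ := eventually_atTop.1 this
    refine ⟨N, fun k hk l hl => ?_⟩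
    rw [dist_eq_norm]
    exact h _ (hfK k) _ (hfK l) (hN k hk).le (hN l hl).le
  obtain ⟨F, hF⟩ := cauchySeq_tendsto_of_complete hcauchy
  have hFK : F ∈ K := hcl.mem_of_tendsto hF (Eventually.of_forall hfK)
  have hFr : ‖F‖ = r := tendsto_nhds_unique hF.norm hlim
  refine ⟨F, ⟨hFK, fun g hg => hFr ▸ hrle g hg⟩, ?_⟩
  rintro G ⟨hGK, hG⟩
  have hGr : ‖G‖ = r := le_antisymm (hFr ▸ hG F hFK) (hrle G hGK)
  by_contra hne'
  have hpos' : 0 < ‖G - F‖ := norm_pos_iff.2 (sub_ne_zero.2 hne')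
  obtain ⟨δ, hδ, h⟩ := close _ hpos'
  exact lt_irrefl _ (h G hGK F hFK (by rw [hGr]; linarith) (by rw [hFr]; linarith))

section Minimal

variable {X : Type*} [MeasurableSpace X] {m : Measure X} {p : ℝ≥0∞}

/-- The class of `ofReal ∘ G`. -/
noncomputable def toENN (G : X →ₘ[m] ℝ) : X →ₘ[m] ℝ≥0∞ :=
  AEEqFun.comp ENNReal.ofReal ENNReal.continuous_ofReal G

theorem coeFn_toENN (G : X →ₘ[m] ℝ) : toENN G =ᵐ[m] fun x => ENNReal.ofReal (G x) :=
  AEEqFun.coeFn_comp _ _ _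

theorem eLpNorm_toENN (G : X →ₘ[m] ℝ) (hG : (0 : X → ℝ) ≤ᵐ[m] G) :
    eLpNorm (toENN G) p m = eLpNorm G p m := by
  refine eLpNorm_congr_enorm_ae ?_
  filter_upwards [coeFn_toENN G, hG] with x h1 h2
  rw [h1, Real.enorm_eq_ofReal h2]; rfl

theorem lintegral_rpow_eq_eLpNorm (h0 : p ≠ 0) (ht : p ≠ ∞) (g : X → ℝ≥0∞) :
    ∫⁻ x, g x ^ p.toReal ∂m = eLpNorm g p m ^ p.toReal := by
  rw [eLpNorm_eq_lintegral_rpow_enorm_toReal h0 ht, ← ENNReal.rpow_mul, one_div,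
    inv_mul_cancel₀ (ENNReal.toReal_pos h0 ht).ne', ENNReal.rpow_one]
  rfl

theorem exists_toENN_eq (h0 : p ≠ 0) (ht : p ≠ ∞) (g : X →ₘ[m] ℝ≥0∞) (hg : eLpNorm g p m < ∞) :
    ∃ G : Lp ℝ p m, (0 : X → ℝ) ≤ᵐ[m] G ∧ toENN (G : X →ₘ[m] ℝ) = g := by
  have hfin : ∀ᵐ x ∂m, g x < ∞ := by
    have h1 : ∫⁻ x, g x ^ p.toReal ∂m ≠ ∞ := by
      rw [lintegral_rpow_eq_eLpNorm h0 ht]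
      exact ENNReal.rpow_ne_top_of_nonneg (by positivity) hg.ne
    filter_upwards [ae_lt_top (g.measurable.pow_const _) h1] with x hx
    exact (ENNReal.rpow_lt_top_iff_of_pos (ENNReal.toReal_pos h0 ht)).1 hx
  have hL : MemLp (fun x => (g x).toReal) p m := by
    refine ⟨g.measurable.ennreal_toReal.aestronglyMeasurable, ?_⟩
    refine lt_of_eq_of_lt (eLpNorm_congr_enorm_ae ?_) hg
    filter_upwards [hfin] with x hx
    rw [Real.enorm_eq_ofReal ENNReal.toReal_nonneg, ENNReal.ofReal_toReal hx.ne]; rfl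
  refine ⟨hL.toLp, ?_, ?_⟩
  · filter_upwards [hL.coeFn_toLp] with x hx
    rw [hx]; exact ENNReal.toReal_nonneg
  · apply AEEqFun.ext
    filter_upwards [coeFn_toENN (hL.toLp : X →ₘ[m] ℝ), hL.coeFn_toLp, hfin] with x h1 h2 h3
    rw [h1, h2, ENNReal.ofReal_toReal h3.ne]

theorem toENN_injOn {G H : Lp ℝ p m} (hG : (0 : X → ℝ) ≤ᵐ[m] G) (hH : (0 : X → ℝ) ≤ᵐ[m] H)
    (h : toENN (G : X →ₘ[m] ℝ) = toENN (H : X →ₘ[m] ℝ)) : G = H := by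
  apply Lp.ext
  have h3 := coeFn_toENN (H : X →ₘ[m] ℝ)
  rw [← h] at h3
  filter_upwards [coeFn_toENN (G : X →ₘ[m] ℝ), h3, hG, hH] with x h1 h2 h4 h5
  rw [h1] at h2
  exact (ENNReal.ofReal_eq_ofReal_iff h4 h5).1 h2

end Minimal

namespace DStructure

variable {X : Type*} [MetricSpace X] [MeasurableSpace X] {p : ℝ≥0∞} {m : Measure X}
  (D : DStructure p m)

theorem existsUnique_minimal (hp : 1 < p) {u : X →ₘ[m] ℝ} (hu : u ∈ D.sobolevClass) :
    ∃! g, g ∈ D.grad u ∧ ∫⁻ x, (g x) ^ p.toReal ∂m = D.energy u univ := by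
  have h0 : p ≠ 0 := (zero_lt_one.trans hp).ne'
  have ht := D.ne_top
  have q0 := D.toReal_pos
  have : Fact (1 ≤ p) := ⟨D.one_le⟩
  let K : Set (Lp ℝ p m) := {G | (0 : X → ℝ) ≤ᵐ[m] G ∧ toENN (G : X →ₘ[m] ℝ) ∈ D.grad u}
  have hne : K.Nonempty := by
    obtain ⟨g, hg, hgi⟩ := D.energy_univ_lt_top.1 hu.2
    rw [lintegral_rpow_eq_eLpNorm h0 ht, ENNReal.rpow_lt_top_iff_of_pos q0] at hgi
    obtain ⟨G, hG, rfl⟩ := exists_toENN_eq h0 ht g hgi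
    exact ⟨G, hG, hg⟩
  have hmid : ∀ f ∈ K, ∀ g ∈ K, (1/2 : ℝ) • (f + g) ∈ K := by
    rintro f ⟨hf, hf'⟩ g ⟨hg, hg'⟩
    have ae : ∀ᵐ x ∂m, ((1/2 : ℝ) • (f + g)) x = 1/2 * f x + 1/2 * g x := by
      filter_upwards [Lp.coeFn_smul (1/2 : ℝ) (f + g), Lp.coeFn_add f g] with x h4 h5
      simp only [h4, h5, Pi.smul_apply, Pi.add_apply, smul_eq_mul]; ring
    refine ⟨?_, ?_⟩
    · filter_upwards [ae, hf, hg] with x h1 h2 h3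
      simp only [Pi.zero_apply] at h2 h3 ⊢
      rw [h1]; positivity
    · have := D.upper_linear u hu.1 u hu.1 _ hf' _ hg' (1/2) (1/2)
        (toENN (((1/2 : ℝ) • (f + g) : Lp ℝ p m) : X →ₘ[m] ℝ)) (by
          filter_upwards [ae, hf, hg, coeFn_toENN (f : X →ₘ[m] ℝ), coeFn_toENN (g : X →ₘ[m] ℝ),
            coeFn_toENN (((1/2 : ℝ) • (f + g) : Lp ℝ p m) : X →ₘ[m] ℝ)] with x h1 h2 h3 h4 h5 h6
          simp only [Pi.zero_apply] at h2 h3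
          rw [h4, h5, h6, h1, ENNReal.ofReal_add (by positivity) (by positivity),
            ENNReal.ofReal_mul (by positivity), ENNReal.ofReal_mul (by positivity),
            Real.enorm_eq_ofReal (by positivity)])
      rwa [← add_smul, show (1/2 : ℝ) + 1/2 = 1 by norm_num, one_smul] at this
  have hcl : IsClosed K := by
    refine IsSeqClosed.isClosed fun F G hF hFG => ?_
    have hpos : (0 : X → ℝ) ≤ᵐ[m] G := by
      have : IsClosed {w : Lp ℝ p m | 0 ≤ w} := isClosed_Ici
      have h := this.mem_of_tendsto hFG (Eventually.of_forall fun n => (Lp.coeFn_nonneg _).1 (hF n).1)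
      exact (Lp.coeFn_nonneg _).2 h
    refine ⟨hpos, D.complete (fun _ => u) (fun n => toENN (F n : X →ₘ[m] ℝ)) (fun _ => hu.1) ?_
      (fun n => (hF n).2) u hu.1 _ ?_ ?_ ?_⟩
    · intro n
      rw [eLpNorm_toENN _ (hF n).1]; exact Lp.eLpNorm_lt_top _
    · rw [eLpNorm_toENN _ hpos]; exact Lp.eLpNorm_lt_top _
    · intro B _ _
      simp
    · have h := (Lp.tendsto_Lp_iff_tendsto_eLpNorm' F G).1 hFG
      refine h.congr fun n => eLpNorm_congr_ae ?_
      filter_upwards [coeFn_toENN (F n : X →ₘ[m] ℝ), coeFn_toENN (G : X →ₘ[m] ℝ), hpos, (hF n).1]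
        with x h1 h2 h3 h4
      simp only [Pi.zero_apply] at h3 h4
      rw [h1, h2, ENNReal.toReal_ofReal h3, ENNReal.toReal_ofReal h4]; rfl
  have hen : ∀ G ∈ K, ∫⁻ x, (toENN (G : X →ₘ[m] ℝ) x) ^ p.toReal ∂m = ‖G‖ₑ ^ p.toReal := by
    intro G hG
    rw [lintegral_rpow_eq_eLpNorm h0 ht, eLpNorm_toENN _ hG.1, Lp.enorm_def]
  have hmin : ∀ F ∈ K, (∀ G ∈ K, ‖F‖ ≤ ‖G‖) ↔
      ∫⁻ x, (toENN (F : X →ₘ[m] ℝ) x) ^ p.toReal ∂m = D.energy u univ := by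
    intro F hF
    constructor
    · intro h
      refine le_antisymm ?_ ?_
      · refine le_iInf₂ fun g hg => ?_
        rw [Measure.restrict_univ]
        by_cases hfin : eLpNorm g p m < ∞
        · obtain ⟨G, hG, rfl⟩ := exists_toENN_eq h0 ht g hfin
          rw [hen F hF, hen G ⟨hG, hg⟩]
          gcongr
          rw [← ofReal_norm, ← ofReal_norm]
          exact ENNReal.ofReal_le_ofReal (h G ⟨hG, hg⟩)
        · rw [lintegral_rpow_eq_eLpNorm h0 ht (g : X → ℝ≥0∞), not_lt_top_iff.1 hfin,
            ENNReal.top_rpow_of_pos q0]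
          exact le_top
      · refine (iInf₂_le _ hF.2).trans ?_
        rw [Measure.restrict_univ]
    · intro h G hG
      have h1 : ‖F‖ₑ ^ p.toReal ≤ ‖G‖ₑ ^ p.toReal := by
        rw [← hen F hF, ← hen G hG, h]
        refine (iInf₂_le _ hG.2).trans ?_
        rw [Measure.restrict_univ]
      rw [ENNReal.rpow_le_rpow_iff q0, ← ofReal_norm, ← ofReal_norm] at h1
      exact (ENNReal.ofReal_le_ofReal_iff (norm_nonneg _)).1 h1
  obtain ⟨F, ⟨hFK, hF⟩, huniq⟩ := Lp_existsUnique_min hp ht K hne (fun f hf => hf.1) hmid hcl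
  refine ⟨toENN (F : X →ₘ[m] ℝ), ⟨hFK.2, (hmin F hFK).1 hF⟩, ?_⟩
  rintro g ⟨hg, hgi⟩
  have hfin : eLpNorm g p m < ∞ := by
    have := hu.2
    rwa [← hgi, lintegral_rpow_eq_eLpNorm h0 ht, ENNReal.rpow_lt_top_iff_of_pos q0] at this
  obtain ⟨G, hG, rfl⟩ := exists_toENN_eq h0 ht g hfin
  rw [huniq G ⟨⟨hG, hg⟩, (hmin G ⟨hG, hg⟩).2 hgi⟩]

theorem minimalGrad_spec (hp : 1 < p) {u : X →ₘ[m] ℝ} (hu : u ∈ D.sobolevClass) :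
    D.minimalGrad u ∈ D.grad u ∧
      ∫⁻ x, (D.minimalGrad u x) ^ p.toReal ∂m = D.energy u univ := by
  have h : ∃ g ∈ D.grad u, ∫⁻ x, (g x) ^ p.toReal ∂m = D.energy u univ :=
    (D.existsUnique_minimal hp hu).exists
  rw [minimalGrad, dif_pos h]
  exact h.choose_spec

theorem eLpNorm_minimalGrad_lt_top (hp : 1 < p) {u : X →ₘ[m] ℝ} (hu : u ∈ D.sobolevClass) :
    eLpNorm (D.minimalGrad u) p m < ∞ := by
  have h := hu.2
  rwa [← (D.minimalGrad_spec hp hu).2, lintegral_rpow_eq_eLpNorm (zero_lt_one.trans hp).ne'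
    D.ne_top, ENNReal.rpow_lt_top_iff_of_pos D.toReal_pos] at h

end DStructure

/-! ### The ring `L^∞(m)` -/

section Linfty

variable {X : Type*} [MeasurableSpace X] {m : Measure X}

/-- The space `L^∞(m)` of (classes of) essentially bounded measurable functions `X → ℝ`. -/
abbrev Linfty (m : Measure X) := Lp ℝ ∞ m

namespace Linfty

noncomputable instance : Mul (Linfty m) where
  mul f g := ((Lp.memLp g).mul (Lp.memLp f) : MemLp (⇑f * ⇑g) ∞ m).toLp

noncomputable instance : One (Linfty m) where
  one := (memLp_top_const (1 : ℝ)).toLp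

theorem coeFn_mul (f g : Linfty m) : ⇑(f * g) =ᵐ[m] fun x => f x * g x :=
  MemLp.coeFn_toLp _

theorem coeFn_one : ⇑(1 : Linfty m) =ᵐ[m] fun _ => 1 :=
  MemLp.coeFn_toLp _

/-- `L^∞(m)` is a commutative ring under a.e. pointwise multiplication. -/
noncomputable instance : CommRing (Linfty m) where
  __ := (inferInstance : AddCommGroup (Lp ℝ ∞ m))
  mul_comm f g := by
    apply Lp.ext
    filter_upwards [coeFn_mul f g, coeFn_mul g f] with x h1 h2
    rw [h1, h2, mul_comm]
  mul_assoc f g h := by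
    apply Lp.ext
    filter_upwards [coeFn_mul f g, coeFn_mul g h, coeFn_mul (f * g) h, coeFn_mul f (g * h)]
      with x h1 h2 h3 h4
    rw [h3, h1, h4, h2, mul_assoc]
  one_mul f := by
    apply Lp.ext
    filter_upwards [coeFn_mul 1 f, coeFn_one (m := m)] with x h1 h2
    rw [h1, h2, one_mul]
  mul_one f := by
    apply Lp.ext
    filter_upwards [coeFn_mul f 1, coeFn_one (m := m)] with x h1 h2
    rw [h1, h2, mul_one]
  left_distrib f g h := by
    apply Lp.ext
    filter_upwards [coeFn_mul f (g + h), coeFn_mul f g, coeFn_mul f h, Lp.coeFn_add g h,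
      Lp.coeFn_add (f * g) (f * h)] with x h1 h2 h3 h4 h5
    rw [h1, h4, h5]
    simp only [Pi.add_apply, h2, h3, mul_add]
  right_distrib f g h := by
    apply Lp.ext
    filter_upwards [coeFn_mul (f + g) h, coeFn_mul f h, coeFn_mul g h, Lp.coeFn_add f g,
      Lp.coeFn_add (f * h) (g * h)] with x h1 h2 h3 h4 h5
    rw [h1, h4, h5]
    simp only [Pi.add_apply, h2, h3, add_mul]
  zero_mul f := by
    apply Lp.ext
    filter_upwards [coeFn_mul 0 f, Lp.coeFn_zero ℝ ∞ m] with x h1 h2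
    rw [h1, h2]; simp
  mul_zero f := by
    apply Lp.ext
    filter_upwards [coeFn_mul f 0, Lp.coeFn_zero ℝ ∞ m] with x h1 h2
    rw [h1, h2]; simp

/-- The characteristic function `χ_B ∈ L^∞(m)` of a Borel set `B`. -/
noncomputable def chi (m : Measure X) (B : Set X) (hB : MeasurableSet B) : Linfty m :=
  ((memLp_top_const (1 : ℝ)).indicator hB : MemLp (B.indicator fun _ => (1 : ℝ)) ∞ m).toLp

theorem coeFn_chi (B : Set X) (hB : MeasurableSet B) :
    ⇑(chi m B hB) =ᵐ[m] B.indicator fun _ => 1 :=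
  MemLp.coeFn_toLp _

/-- Real simple functions as elements of `L^∞(m)`. -/
noncomputable def ofSimple : SimpleFunc X ℝ →ₗ[ℝ] Linfty m where
  toFun h := (h.memLp_top m).toLp
  map_add' _ _ := (MemLp.toLp_add _ _)
  map_smul' c _ := (MemLp.toLp_const_smul c _)

theorem coeFn_ofSimple (h : SimpleFunc X ℝ) : ⇑(ofSimple h : Linfty m) =ᵐ[m] h :=
  MemLp.coeFn_toLp (h.memLp_top m)

theorem norm_le_of_ae {p : ℝ≥0∞} (f : Linfty m) (v w : Lp ℝ p m)
    (h : ∀ᵐ x ∂m, |w x| ≤ |f x| * |v x|) : ‖w‖ ≤ ‖f‖ * ‖v‖ := by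
  refine Lp.norm_le_mul_norm_of_ae_le_mul ?_
  have : ∀ᵐ x ∂m, ‖f x‖ ≤ ‖f‖ := by
    have h1 := ae_le_eLpNormEssSup (f := f) (μ := m)
    filter_upwards [h1] with x hx
    rw [Lp.norm_def, eLpNorm_exponent_top, ← toReal_enorm]
    refine ENNReal.toReal_mono ?_ hx
    rw [← eLpNorm_exponent_top]; exact Lp.eLpNorm_ne_top _
  filter_upwards [this, h] with x h1 h2
  exact h2.trans (mul_le_mul_of_nonneg_right h1 (abs_nonneg _))

theorem denseRange_ofSimple : DenseRange (ofSimple : SimpleFunc X ℝ → Linfty m) := by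
  intro f
  rw [Metric.mem_closure_iff]
  intro ε hε
  set C := ‖f‖
  have hb : ∀ᵐ x ∂m, ‖f x‖ ≤ C := by
    have h1 := ae_le_eLpNormEssSup (f := f) (μ := m)
    filter_upwards [h1] with x hx
    rw [show C = ‖f‖ from rfl, Lp.norm_def, eLpNorm_exponent_top, ← toReal_enorm]
    refine ENNReal.toReal_mono ?_ hx
    rw [← eLpNorm_exponent_top]; exact Lp.eLpNorm_ne_top _
  have hfm : Measurable f := (Lp.stronglyMeasurable f).measurable
  let δ := ε / 2
  have hδ : 0 < δ := by positivity
  let k : X → ℤ := fun x => ⌊max (-C) (min C (f x)) / δ⌋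
  have hk : Measurable k :=
    (((measurable_const.max (measurable_const.min hfm)).div_const δ)).floor
  have hfin : (range k).Finite := by
    refine (Set.finite_Icc ⌊-C / δ⌋ ⌊C / δ⌋).subset ?_
    rintro _ ⟨x, rfl⟩
    have hC : 0 ≤ C := norm_nonneg _
    constructor
    · exact Int.floor_le_floor (div_le_div_of_nonneg_right (le_max_left _ _) hδ.le)
    · exact Int.floor_le_floor (div_le_div_of_nonneg_right
        (max_le (by linarith) (min_le_left _ _)) hδ.le)
  let h : SimpleFunc X ℝ := (SimpleFunc.mk k (fun z => hk (measurableSet_singleton z)) hfin).map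
    fun z : ℤ => (z : ℝ) * δ
  refine ⟨ofSimple h, ⟨h, rfl⟩, ?_⟩
  rw [dist_eq_norm]
  refine lt_of_le_of_lt ?_ (half_lt_self hε)
  rw [Lp.norm_def]
  refine ENNReal.toReal_le_of_le_ofReal hδ.le ?_
  rw [eLpNorm_exponent_top]
  refine eLpNormEssSup_le_of_ae_bound ?_
  filter_upwards [hb, Lp.coeFn_sub f (ofSimple h), coeFn_ofSimple (m := m) h] with x h1 h2 h3
  rw [h2, Pi.sub_apply, h3]
  have h4 : h x = (⌊f x / δ⌋ : ℤ) * δ := by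
    have h5 := abs_le.1 h1
    change ((⌊max (-C) (min C (f x)) / δ⌋ : ℤ) : ℝ) * δ = _
    rw [min_eq_right h5.2, max_eq_right h5.1]
  have h6 := Int.floor_le (f x / δ)
  have h7 := Int.lt_floor_add_one (f x / δ)
  rw [le_div_iff₀ hδ] at h6
  rw [div_lt_iff₀ hδ] at h7
  rw [h4, Real.norm_eq_abs, abs_le]
  have e : δ = ε / 2 := rfl
  constructor <;> nlinarith

end Linfty

end Linfty

/-! ### Normed modules and the cotangent module -/

section NormedModule

variable {X : Type*} [MeasurableSpace X]

/-- `(M, ‖·‖, ·, |·|)` is an `L^p(m)`-normed `L^∞(m)`-module: `M` is a Banach space and a module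
over the ring `L^∞(m)` (the real scalars acting as the constants of `L^∞(m)`), and the pointwise
norm `|·|` takes values in the nonnegative functions with `|f v| = |f| |v|` a.e. and
`‖v‖ = ‖ |v| ‖_{L^p(m)}`; the latter makes `|v|` an element of `L^p(m)`. -/
structure IsLpNormedModule (p : ℝ≥0∞) (m : Measure X) (M : Type*) [NormedAddCommGroup M]
    [NormedSpace ℝ M] [Module (Linfty m) M] (pnorm : M → (X →ₘ[m] ℝ≥0∞)) : Prop where
  complete : CompleteSpace M
  const_smul : ∀ (c : ℝ) (v : M), (c • (1 : Linfty m)) • v = c • v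
  pnorm_smul : ∀ (f : Linfty m) (v : M), ∀ᵐ x ∂m, pnorm (f • v) x = ‖f x‖ₑ * pnorm v x
  enorm_eq : ∀ v : M, ‖v‖ₑ = eLpNorm (pnorm v) p m

end NormedModule

/-- `(M, d)`, with pointwise norm `pnorm`, is the cotangent module `L^p(T^*X; D)` together with its
differential `d : S^p(X) → L^p(T^*X; D)`. The couple is characterized, up to a unique isomorphism,
by: `M` is an `L^p`-normed `L^∞`-module, `d` is linear, `|du|` is the minimal pseudo-gradient of `u`
for every `u ∈ S^p(X)`, and the finite sums `∑ i, χ_{B_i} du_i` with `(B_i)` a Borel partition of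
`X` are dense in `M`. -/
structure DStructure.IsCotangentModule {X : Type*} [MetricSpace X] [MeasurableSpace X]
    {p : ℝ≥0∞} {m : Measure X} (D : DStructure p m) (M : Type*) [NormedAddCommGroup M]
    [NormedSpace ℝ M] [Module (Linfty m) M] (pnorm : M → (X →ₘ[m] ℝ≥0∞))
    (d : D.sobolevClass →ₗ[ℝ] M) : Prop extends IsLpNormedModule p m M pnorm where
  pnorm_d : ∀ u : D.sobolevClass, pnorm (d u) = D.minimalGrad u
  dense : Dense {ω : M | ∃ (n : ℕ) (B : Fin n → Set X) (hB : ∀ i, MeasurableSet (B i))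
    (u : Fin n → D.sobolevClass), Pairwise (fun i j => Disjoint (B i) (B j)) ∧
    (⋃ i, B i) = univ ∧ ω = ∑ i, Linfty.chi m (B i) (hB i) • d (u i)}

/-! ### Existence of the cotangent module -/

section Construction

/-- A vector space with a pointwise seminorm. -/
structure PointwiseSeminorm (S : Type*) [AddCommGroup S] [Module ℝ S] {X : Type*}
    [MeasurableSpace X] (p : ℝ≥0∞) (m : Measure X) where
  toLp : S → Lp ℝ p m
  nonneg : ∀ u, ∀ᵐ x ∂m, 0 ≤ toLp u x
  add_le : ∀ u v, ∀ᵐ x ∂m, toLp (u + v) x ≤ toLp u x + toLp v x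
  smul_eq : ∀ (c : ℝ) u, ∀ᵐ x ∂m, toLp (c • u) x = |c| * toLp u x

namespace PointwiseSeminorm

variable {S : Type*} [AddCommGroup S] [Module ℝ S] {X : Type*} [MeasurableSpace X]
  {p : ℝ≥0∞} {m : Measure X} (G : PointwiseSeminorm S p m)

theorem ae_simple {T : Type*} (f : SimpleFunc X T) {P : T → X → Prop}
    (h : ∀ u, ∀ᵐ x ∂m, P u x) : ∀ᵐ x ∂m, P (f x) x := by
  have : ∀ᵐ x ∂m, ∀ u ∈ f.range, P u x := (Filter.eventually_all_finset f.range).2 fun u _ => h u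
  filter_upwards [this] with x hx
  exact hx _ (f.mem_range_self x)

theorem memLp_simple (f : SimpleFunc X S) : MemLp (fun x => G.toLp (f x) x) p m := by
  classical
  have e : (fun x => G.toLp (f x) x)
      = fun x => ∑ u ∈ f.range, (f ⁻¹' {u}).indicator (G.toLp u) x := by
    funext x
    rw [Finset.sum_eq_single (f x)]
    · simp
    · intro u _ hu
      exact indicator_of_notMem (by simpa using hu.symm) _
    · intro h; exact absurd (f.mem_range_self x) h
  rw [e]
  exact memLp_finsetSum _ fun u _ => (Lp.memLp (G.toLp u)).indicator (f.measurableSet_fiber u)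

/-- Simple functions with values in `S`, that is, finite families `(B_i, u_i)`. -/
def Pre (_ : PointwiseSeminorm S p m) := SimpleFunc X S

noncomputable instance : AddCommGroup G.Pre := inferInstanceAs (AddCommGroup (SimpleFunc X S))
noncomputable instance : Module ℝ G.Pre := inferInstanceAs (Module ℝ (SimpleFunc X S))

/-- The pointwise norm of a simple function. -/
noncomputable def preNorm (f : G.Pre) : Lp ℝ p m := (G.memLp_simple f).toLp

/-- The underlying simple function. -/
def Pre.fn {G : PointwiseSeminorm S p m} (f : G.Pre) : SimpleFunc X S := f

theorem coeFn_preNorm (f : G.Pre) : G.preNorm f =ᵐ[m] fun x => G.toLp (f.fn x) x :=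
  MemLp.coeFn_toLp (G.memLp_simple f)

theorem preNorm_nonneg (f : G.Pre) : ∀ᵐ x ∂m, 0 ≤ G.preNorm f x := by
  filter_upwards [G.coeFn_preNorm f, ae_simple f.fn G.nonneg] with x h1 h2
  rw [h1]; exact h2

theorem preNorm_add (f g : G.Pre) : ∀ᵐ x ∂m, G.preNorm (f + g) x ≤ G.preNorm f x + G.preNorm g x := by
  filter_upwards [G.coeFn_preNorm f, G.coeFn_preNorm g, G.coeFn_preNorm (f + g),
    ae_simple (f.fn.pair g.fn) (P := fun q x => G.toLp (q.1 + q.2) x ≤ G.toLp q.1 x + G.toLp q.2 x)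
      fun q => G.add_le q.1 q.2] with x h1 h2 h3 h4
  rw [h1, h2, h3]; exact h4

theorem preNorm_smul (c : ℝ) (f : G.Pre) : ∀ᵐ x ∂m, G.preNorm (c • f) x = |c| * G.preNorm f x := by
  filter_upwards [G.coeFn_preNorm f, G.coeFn_preNorm (c • f), ae_simple f.fn (G.smul_eq c)]
    with x h1 h2 h3
  rw [h1, h2]; exact h3

/-- Action of real simple functions on simple functions. -/
noncomputable def act (h : SimpleFunc X ℝ) : G.Pre →ₗ[ℝ] G.Pre where
  toFun f := ((h.pair f.fn).map fun q => q.1 • q.2 : SimpleFunc X S)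
  map_add' f g := by
    refine SimpleFunc.ext fun x => ?_
    exact smul_add (h x) (f.fn x) (g.fn x)
  map_smul' c f := by
    refine SimpleFunc.ext fun x => ?_
    exact smul_comm (h x) c (f.fn x)

theorem preNorm_act (h : SimpleFunc X ℝ) (f : G.Pre) :
    ∀ᵐ x ∂m, G.preNorm (G.act h f) x = |h x| * G.preNorm f x := by
  filter_upwards [G.coeFn_preNorm f, G.coeFn_preNorm (G.act h f),
    ae_simple (h.pair f.fn) (P := fun q x => G.toLp (q.1 • q.2) x = |q.1| * G.toLp q.2 x)
      fun q => G.smul_eq q.1 q.2] with x h1 h2 h3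
  rw [h1, h2]; exact h3

noncomputable instance : Norm G.Pre := ⟨fun f => ‖G.preNorm f‖⟩

theorem norm_def (f : G.Pre) : ‖f‖ = ‖G.preNorm f‖ := rfl

variable [Fact (1 ≤ p)]

theorem core : SeminormedSpace.Core ℝ G.Pre where
  norm_nonneg f := norm_nonneg (G.preNorm f)
  norm_smul c f := by
    rw [norm_def, norm_def, ← norm_smul, Lp.norm_def, Lp.norm_def]
    congr 1
    refine eLpNorm_congr_norm_ae ?_
    filter_upwards [G.preNorm_smul c f, Lp.coeFn_smul c (G.preNorm f)] with x h1 h2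
    rw [h1, h2]; simp
  norm_triangle f g := by
    refine le_trans (Lp.norm_le_norm_of_ae_le ?_) (norm_add_le (G.preNorm f) (G.preNorm g))
    filter_upwards [G.preNorm_add f g, Lp.coeFn_add (G.preNorm f) (G.preNorm g),
      G.preNorm_nonneg (f + g), G.preNorm_nonneg f, G.preNorm_nonneg g] with x h1 h2 h3 h4 h5
    rw [h2, Pi.add_apply, Real.norm_of_nonneg h3, Real.norm_of_nonneg (add_nonneg h4 h5)]
    exact h1

noncomputable instance : SeminormedAddCommGroup G.Pre := SeminormedAddCommGroup.ofCore G.core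
noncomputable instance : NormedSpace ℝ G.Pre := { norm_smul_le := fun c f => (G.core.norm_smul c f).le }

/-- The completion of the space of simple functions. -/
abbrev Mod := UniformSpace.Completion G.Pre

theorem lipschitz_preNorm : LipschitzWith 1 G.preNorm := by
  refine LipschitzWith.of_dist_le_mul fun f g => ?_
  rw [NNReal.coe_one, one_mul, dist_eq_norm, dist_eq_norm, norm_def]
  refine Lp.norm_le_norm_of_ae_le ?_
  have h1 := G.preNorm_add (f - g) g
  have h2 := G.preNorm_add (g - f) f
  have h3 := G.preNorm_smul (-1) (f - g)
  rw [sub_add_cancel] at h1 h2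
  rw [neg_one_smul, neg_sub] at h3
  filter_upwards [h1, h2, h3, Lp.coeFn_sub (G.preNorm f) (G.preNorm g), G.preNorm_nonneg (f - g)]
    with x h1 h2 h3 h4 h5
  rw [h4, Pi.sub_apply, Real.norm_of_nonneg h5, Real.norm_eq_abs, abs_le]
  rw [h3] at h2
  simp only [abs_neg, abs_one, one_mul] at h2
  constructor <;> linarith

/-- The pointwise norm on the completion. -/
noncomputable def pn : G.Mod → Lp ℝ p m := UniformSpace.Completion.extension G.preNorm

theorem pn_coe (f : G.Pre) : G.pn f = G.preNorm f :=
  UniformSpace.Completion.extension_coe G.lipschitz_preNorm.uniformContinuous f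

theorem continuous_pn : Continuous G.pn := UniformSpace.Completion.continuous_extension

theorem norm_pn (v : G.Mod) : ‖G.pn v‖ = ‖v‖ := by
  induction v using UniformSpace.Completion.induction_on with
  | hp => exact isClosed_eq G.continuous_pn.norm continuous_norm
  | ih f => rw [pn_coe, UniformSpace.Completion.norm_coe, norm_def]

theorem pn_nonneg (v : G.Mod) : 0 ≤ G.pn v := by
  induction v using UniformSpace.Completion.induction_on with
  | hp => exact isClosed_le continuous_const G.continuous_pn
  | ih f =>
    rw [pn_coe, ← Lp.coeFn_nonneg]
    exact G.preNorm_nonneg f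

theorem norm_act_le (h : SimpleFunc X ℝ) (f : G.Pre) :
    ‖G.act h f‖ ≤ ‖(Linfty.ofSimple h : Linfty m)‖ * ‖f‖ := by
  refine Linfty.norm_le_of_ae _ _ _ ?_
  filter_upwards [G.preNorm_act h f, Linfty.coeFn_ofSimple (m := m) h] with x h1 h2
  rw [h1, h2, abs_mul, abs_abs]

/-- The inclusion of simple functions in the completion. -/
noncomputable def incl : G.Pre →ₗ[ℝ] G.Mod :=
  (UniformSpace.Completion.toComplL : G.Pre →L[ℝ] G.Mod).toLinearMap

theorem incl_apply (f : G.Pre) : G.incl f = (f : G.Mod) := rfl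

theorem denseRange_incl : DenseRange G.incl := UniformSpace.Completion.denseRange_coe

theorem norm_incl (f : G.Pre) : ‖G.incl f‖ = ‖f‖ := UniformSpace.Completion.norm_coe f

/-- Action of a real simple function on the completion. -/
noncomputable def actMod (h : SimpleFunc X ℝ) : G.Mod →L[ℝ] G.Mod :=
  (G.incl.comp (G.act h)).extendOfNorm G.incl

theorem actMod_incl (h : SimpleFunc X ℝ) (f : G.Pre) :
    G.actMod h (G.incl f) = G.incl (G.act h f) :=
  LinearMap.extendOfNorm_eq G.denseRange_incl ⟨‖(Linfty.ofSimple h : Linfty m)‖, fun f => by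
    rw [LinearMap.comp_apply, norm_incl, norm_incl]; exact G.norm_act_le h f⟩ f

theorem norm_actMod_le (h : SimpleFunc X ℝ) :
    ‖G.actMod h‖ ≤ ‖(Linfty.ofSimple h : Linfty m)‖ := by
  refine ContinuousLinearMap.opNorm_le_bound _ (norm_nonneg _) fun v => ?_
  refine LinearMap.norm_extendOfNorm_apply_le G.denseRange_incl _ (fun f => ?_) v
  rw [LinearMap.comp_apply, norm_incl, norm_incl]; exact G.norm_act_le h f

theorem clm_ext {A B : G.Mod →L[ℝ] G.Mod} (h : ∀ f, A (G.incl f) = B (G.incl f)) : A = B := by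
  refine DFunLike.coe_injective ?_
  exact G.denseRange_incl.equalizer A.continuous B.continuous (funext h)

/-- The action of real simple functions, as a linear map. -/
noncomputable def actLin : SimpleFunc X ℝ →ₗ[ℝ] (G.Mod →L[ℝ] G.Mod) where
  toFun := G.actMod
  map_add' h k := by
    refine G.clm_ext fun f => ?_
    rw [add_apply, actMod_incl, actMod_incl, actMod_incl, ← map_add]
    congr 1
    refine SimpleFunc.ext fun x => ?_
    exact add_smul (h x) (k x) (f.fn x)
  map_smul' c h := by
    refine G.clm_ext fun f => ?_
    rw [smul_apply, actMod_incl, actMod_incl, ← map_smul]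
    congr 1
    refine SimpleFunc.ext fun x => ?_
    exact smul_assoc c (h x) (f.fn x)

/-- The action of `L^∞(m)` on the completion. -/
noncomputable def actL : Linfty m →L[ℝ] (G.Mod →L[ℝ] G.Mod) :=
  G.actLin.extendOfNorm Linfty.ofSimple

theorem actL_ofSimple (h : SimpleFunc X ℝ) : G.actL (Linfty.ofSimple h) = G.actMod h :=
  LinearMap.extendOfNorm_eq Linfty.denseRange_ofSimple
    ⟨1, fun h => by rw [one_mul]; exact G.norm_actMod_le h⟩ h

theorem continuous_mul_left (f : Linfty m) : Continuous fun g : Linfty m => f * g := by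
  let T : Linfty m →ₗ[ℝ] Linfty m :=
    { toFun := fun g => f * g
      map_add' := mul_add f
      map_smul' := fun c g => by
        apply Lp.ext
        filter_upwards [Linfty.coeFn_mul f (c • g), Linfty.coeFn_mul f g, Lp.coeFn_smul c g,
          Lp.coeFn_smul c (f * g)] with x h1 h2 h3 h4
        simp only [RingHom.id_apply]
        rw [h1, h3, h4]; simp only [Pi.smul_apply, h2, smul_eq_mul]; ring }
  refine (T.mkContinuous ‖f‖ fun g => Linfty.norm_le_of_ae _ _ _ ?_).continuous
  filter_upwards [Linfty.coeFn_mul f g] with x h1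
  change |(f * g) x| ≤ _
  rw [h1, abs_mul]

theorem ofSimple_mul (h k : SimpleFunc X ℝ) :
    (Linfty.ofSimple (h * k) : Linfty m) = Linfty.ofSimple h * Linfty.ofSimple k := by
  apply Lp.ext
  filter_upwards [Linfty.coeFn_ofSimple (m := m) (h * k), Linfty.coeFn_ofSimple (m := m) h,
    Linfty.coeFn_ofSimple (m := m) k,
    Linfty.coeFn_mul (Linfty.ofSimple h : Linfty m) (Linfty.ofSimple k)] with x h1 h2 h3 h4
  rw [h1, h4, h2, h3]; rfl

theorem actL_mul (f g : Linfty m) : G.actL (f * g) = (G.actL f).comp (G.actL g) := by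
  have h1 : ∀ h k : SimpleFunc X ℝ, G.actL (Linfty.ofSimple h * Linfty.ofSimple k)
      = (G.actL (Linfty.ofSimple h)).comp (G.actL (Linfty.ofSimple k)) := by
    intro h k
    rw [← ofSimple_mul, actL_ofSimple, actL_ofSimple, actL_ofSimple]
    refine G.clm_ext fun f => ?_
    rw [ContinuousLinearMap.comp_apply, actMod_incl, actMod_incl, actMod_incl]
    congr 1
    refine SimpleFunc.ext fun x => ?_
    exact mul_smul (h x) (k x) (f.fn x)
  have h2 : ∀ (h : SimpleFunc X ℝ) (g : Linfty m), G.actL (Linfty.ofSimple h * g)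
      = (G.actL (Linfty.ofSimple h)).comp (G.actL g) := by
    intro h g
    refine Linfty.denseRange_ofSimple.induction_on g (isClosed_eq ?_ ?_) (h1 h)
    · exact G.actL.continuous.comp (continuous_mul_left _)
    · exact continuous_const.clm_comp G.actL.continuous
  refine Linfty.denseRange_ofSimple.induction_on f (isClosed_eq ?_ ?_) fun h => h2 h g
  · have : (fun f : Linfty m => f * g) = fun f => g * f := funext fun f => mul_comm f g
    exact G.actL.continuous.comp (this ▸ continuous_mul_left g)
  · exact G.actL.continuous.clm_comp continuous_const

theorem one_eq_ofSimple : (1 : Linfty m) = Linfty.ofSimple (1 : SimpleFunc X ℝ) := by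
  apply Lp.ext
  filter_upwards [Linfty.coeFn_ofSimple (m := m) (1 : SimpleFunc X ℝ), Linfty.coeFn_one (m := m)]
    with x h1 h2
  rw [h1, h2]; rfl

theorem actL_one : G.actL 1 = 1 := by
  rw [one_eq_ofSimple, actL_ofSimple]
  refine G.clm_ext fun f => ?_
  rw [actMod_incl, one_apply_eq_self]
  congr 1
  refine SimpleFunc.ext fun x => ?_
  exact one_smul ℝ (f.fn x)

/-- The action of `L^∞(m)`, as a ring homomorphism. -/
noncomputable def actHom : Linfty m →+* (G.Mod →L[ℝ] G.Mod) where
  toFun := G.actL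
  map_one' := G.actL_one
  map_mul' := G.actL_mul
  map_zero' := map_zero _
  map_add' := map_add _

noncomputable instance : Module (Linfty m) G.Mod := Module.compHom G.Mod G.actHom

theorem linfty_smul_def (f : Linfty m) (v : G.Mod) : f • v = G.actL f v := rfl

/-- Multiplication of `L^p` by `L^∞`. -/
noncomputable def mulL : Linfty m →L[ℝ] Lp ℝ p m →L[ℝ] Lp ℝ p m :=
  (ContinuousLinearMap.mul ℝ ℝ).holderL m ∞ p p

theorem coeFn_mulL (f : Linfty m) (w : Lp ℝ p m) : mulL f w =ᵐ[m] fun x => f x * w x :=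
  (ContinuousLinearMap.mul ℝ ℝ).coeFn_holder (r := p) f w

theorem pn_smul (f : Linfty m) (v : G.Mod) : G.pn (f • v) = |mulL f (G.pn v)| := by
  rw [linfty_smul_def]
  have h1 : ∀ (h : SimpleFunc X ℝ) (g : G.Pre),
      G.pn (G.actL (Linfty.ofSimple h) (G.incl g)) =
        |mulL (Linfty.ofSimple h) (G.pn (G.incl g))| := by
    intro h g
    rw [actL_ofSimple, actMod_incl, incl_apply, incl_apply, pn_coe, pn_coe]
    apply Lp.ext
    filter_upwards [G.preNorm_act h g, Lp.coeFn_abs (mulL (Linfty.ofSimple h) (G.preNorm g)),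
      coeFn_mulL (Linfty.ofSimple h) (G.preNorm g), Linfty.coeFn_ofSimple (m := m) h,
      G.preNorm_nonneg g] with x h1 h2 h3 h4 h5
    rw [h1, h2, h3, h4, abs_mul, abs_of_nonneg h5]
  have habs : Continuous fun w : Lp ℝ p m => |w| :=
    continuous_id.sup continuous_neg
  have h2 : ∀ (h : SimpleFunc X ℝ) (v : G.Mod),
      G.pn (G.actL (Linfty.ofSimple h) v) = |mulL (Linfty.ofSimple h) (G.pn v)| := by
    intro h v
    refine G.denseRange_incl.induction_on v (isClosed_eq ?_ ?_) (h1 h)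
    · exact G.continuous_pn.comp (G.actL _).continuous
    · exact habs.comp ((mulL _).continuous.comp G.continuous_pn)
  refine Linfty.denseRange_ofSimple.induction_on f (isClosed_eq ?_ ?_) fun h => h2 h v
  · exact G.continuous_pn.comp (G.actL.continuous.clm_apply continuous_const)
  · exact habs.comp (mulL.continuous.clm_apply continuous_const)

theorem isLpNormedModule : IsLpNormedModule p m G.Mod fun v => toENN (G.pn v : X →ₘ[m] ℝ) where
  complete := inferInstance
  const_smul c v := by
    rw [linfty_smul_def, map_smul, actL_one]; rfl
  pnorm_smul f v := by
    rw [pn_smul]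
    filter_upwards [coeFn_toENN ((|mulL f (G.pn v)| : Lp ℝ p m) : X →ₘ[m] ℝ),
      coeFn_toENN (G.pn v : X →ₘ[m] ℝ), Lp.coeFn_abs (mulL f (G.pn v)), coeFn_mulL f (G.pn v),
      (Lp.coeFn_nonneg _).2 (G.pn_nonneg v)] with x h1 h2 h3 h4 h5
    rw [h1, h2, h3, h4, abs_mul, ENNReal.ofReal_mul (abs_nonneg _), abs_of_nonneg h5,
      Real.enorm_eq_ofReal_abs]
  enorm_eq v := by
    rw [eLpNorm_toENN _ ((Lp.coeFn_nonneg _).2 (G.pn_nonneg v)), ← Lp.enorm_def, ← ofReal_norm,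
      ← ofReal_norm, norm_pn]

/-- Constant simple functions. -/
noncomputable def constPre : S →ₗ[ℝ] G.Pre where
  toFun u := (SimpleFunc.const X u : SimpleFunc X S)
  map_add' _ _ := SimpleFunc.ext fun _ => rfl
  map_smul' _ _ := SimpleFunc.ext fun _ => rfl

/-- The differential: constant simple functions in the completion. -/
noncomputable def diff : S →ₗ[ℝ] G.Mod := G.incl.comp G.constPre

/-- Evaluation of simple functions at a point. -/
def eval (x : X) : G.Pre →+ S where
  toFun f := f.fn x
  map_zero' := rfl
  map_add' _ _ := rfl

theorem pn_diff (u : S) : G.pn (G.diff u) = G.toLp u := by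
  refine (G.pn_coe (G.constPre u)).trans ?_
  apply Lp.ext
  exact G.coeFn_preNorm (G.constPre u)

theorem dense_diff : Dense {ω : G.Mod | ∃ (n : ℕ) (B : Fin n → Set X)
    (hB : ∀ i, MeasurableSet (B i)) (u : Fin n → S), Pairwise (fun i j => Disjoint (B i) (B j)) ∧
    (⋃ i, B i) = univ ∧ ω = ∑ i, Linfty.chi m (B i) (hB i) • G.diff (u i)} := by
  refine G.denseRange_incl.mono ?_
  rintro _ ⟨f, rfl⟩
  classical
  let e := f.fn.range.equivFin.symm
  refine ⟨_, fun i => f.fn ⁻¹' {(e i : S)}, fun i => f.fn.measurableSet_fiber _, fun i => e i,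
    ?_, ?_, ?_⟩
  · intro i j hij
    refine Set.disjoint_left.2 fun x hx hy => hij ?_
    exact e.injective (Subtype.ext (hx.symm.trans hy))
  · refine eq_univ_of_forall fun x => mem_iUnion.2 ⟨e.symm ⟨f.fn x, f.fn.mem_range_self x⟩, ?_⟩
    simp
  · have hχ : ∀ (B : Set X) (hB : MeasurableSet B), Linfty.chi m B hB =
        Linfty.ofSimple (SimpleFunc.piecewise B hB (SimpleFunc.const X 1) (SimpleFunc.const X 0)) := by
      intro B hB
      apply Lp.ext
      filter_upwards [Linfty.coeFn_chi (m := m) B hB, Linfty.coeFn_ofSimple (m := m)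
        (SimpleFunc.piecewise B hB (SimpleFunc.const X 1) (SimpleFunc.const X 0))] with x h1 h2
      rw [h1, h2]
      by_cases hx : x ∈ B <;> simp [hx]
    have h1 : ∀ i, Linfty.chi m (f.fn ⁻¹' {(e i : S)}) (f.fn.measurableSet_fiber _) •
        G.diff (e i : S) = G.incl (G.act (SimpleFunc.piecewise (f.fn ⁻¹' {(e i : S)})
          (f.fn.measurableSet_fiber _) (SimpleFunc.const X 1) (SimpleFunc.const X 0))
          (G.constPre (e i))) := by
      intro i
      rw [linfty_smul_def, hχ, actL_ofSimple, ← actMod_incl]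
      rfl
    rw [Finset.sum_congr rfl fun i _ => h1 i, ← map_sum]
    congr 1
    refine SimpleFunc.ext fun x => ?_
    change G.eval x f = G.eval x _
    rw [map_sum, Finset.sum_eq_single (e.symm ⟨f.fn x, f.fn.mem_range_self x⟩)]
    · change f.fn x = (SimpleFunc.piecewise _ _ _ _ : SimpleFunc X ℝ) x • (_ : S)
      rw [SimpleFunc.piecewise_apply, if_pos (by simp)]
      simp only [SimpleFunc.const_apply, one_smul, Equiv.apply_symm_apply]
      rfl
    · intro j _ hj
      change (SimpleFunc.piecewise _ _ _ _ : SimpleFunc X ℝ) x • (_ : S) = 0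
      rw [SimpleFunc.piecewise_apply, if_neg]
      · simp
      · intro hx
        apply hj
        rw [Equiv.eq_symm_apply]
        exact Subtype.ext hx.symm
    · intro h; exact absurd (Finset.mem_univ _) h

end PointwiseSeminorm

end Construction

namespace DStructure

variable {X : Type*} [MetricSpace X] [MeasurableSpace X] {p : ℝ≥0∞} {m : Measure X}
  (D : DStructure p m)

theorem minimalGrad_add_le (hp : 1 < p) (hD : D.IsPointwiseLocal) {u v : X →ₘ[m] ℝ}
    (hu : u ∈ D.sobolevClass) (hv : v ∈ D.sobolevClass) :
    ∀ᵐ x ∂m, D.minimalGrad (u + v) x ≤ D.minimalGrad u x + D.minimalGrad v x := by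
  have h := D.upper_linear u hu.1 v hv.1 _ (D.minimalGrad_spec hp hu).1 _
    (D.minimalGrad_spec hp hv).1 1 1 (D.minimalGrad u + D.minimalGrad v) (by
      filter_upwards [AEEqFun.coeFn_add (D.minimalGrad u) (D.minimalGrad v)] with x hx
      simp [hx])
  rw [one_smul, one_smul] at h
  filter_upwards [hD.minimalGrad_le _ (add_mem hu hv) _ h,
    AEEqFun.coeFn_add (D.minimalGrad u) (D.minimalGrad v)] with x h1 h2
  rw [h2] at h1; exact h1

theorem minimalGrad_smul_le (hp : 1 < p) (hD : D.IsPointwiseLocal) (c : ℝ) {u : X →ₘ[m] ℝ}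
    (hu : u ∈ D.sobolevClass) :
    ∀ᵐ x ∂m, D.minimalGrad (c • u) x ≤ ‖c‖ₑ * D.minimalGrad u x := by
  have hm : Measurable fun x => ‖c‖ₑ * D.minimalGrad u x :=
    (D.minimalGrad u).measurable.const_mul _
  have hmk := AEEqFun.coeFn_mk _ hm.aestronglyMeasurable (μ := m)
  have h := D.upper_linear u hu.1 u hu.1 _ (D.minimalGrad_spec hp hu).1 _
    (D.minimalGrad_spec hp hu).1 c 0 (AEEqFun.mk _ hm.aestronglyMeasurable) (by
      filter_upwards [hmk] with x hx
      simp [hx])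
  rw [zero_smul, add_zero] at h
  filter_upwards [hD.minimalGrad_le _ (D.sobolevClass.smul_mem c hu) _ h, hmk] with x h1 h2
  rw [h2] at h1; exact h1

theorem minimalGrad_smul (hp : 1 < p) (hD : D.IsPointwiseLocal) (c : ℝ) {u : X →ₘ[m] ℝ}
    (hu : u ∈ D.sobolevClass) :
    ∀ᵐ x ∂m, D.minimalGrad (c • u) x = ‖c‖ₑ * D.minimalGrad u x := by
  by_cases hc : c = 0
  · filter_upwards [D.minimalGrad_smul_le hp hD c hu] with x hx
    subst hc
    simpa using hx
  · have h := D.minimalGrad_smul_le hp hD c⁻¹ (D.sobolevClass.smul_mem c hu)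
    rw [inv_smul_smul₀ hc] at h
    filter_upwards [D.minimalGrad_smul_le hp hD c hu, h] with x h1 h2
    refine le_antisymm h1 ?_
    calc ‖c‖ₑ * D.minimalGrad u x ≤ ‖c‖ₑ * (‖c⁻¹‖ₑ * D.minimalGrad (c • u) x) := by gcongr
      _ = D.minimalGrad (c • u) x := by
        rw [← mul_assoc, ← enorm_mul, mul_inv_cancel₀ hc, enorm_one, one_mul]

theorem exists_toENN_eq_minimalGrad (hp : 1 < p) (u : D.sobolevClass) :
    ∃ G : Lp ℝ p m, (0 : X → ℝ) ≤ᵐ[m] G ∧ toENN (G : X →ₘ[m] ℝ) = D.minimalGrad u :=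
  exists_toENN_eq (zero_lt_one.trans hp).ne' D.ne_top _ (D.eLpNorm_minimalGrad_lt_top hp u.2)

/-- The pointwise seminorm on `S^p(X)` given by the minimal pseudo-gradient. -/
noncomputable def pointwiseSeminorm (hp : 1 < p) (hD : D.IsPointwiseLocal) :
    PointwiseSeminorm D.sobolevClass p m where
  toLp u := (D.exists_toENN_eq_minimalGrad hp u).choose
  nonneg u := (D.exists_toENN_eq_minimalGrad hp u).choose_spec.1
  add_le u v := by
    have a := (D.exists_toENN_eq_minimalGrad hp u).choose_spec
    have b := (D.exists_toENN_eq_minimalGrad hp v).choose_spec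
    have c := (D.exists_toENN_eq_minimalGrad hp (u + v)).choose_spec
    set A := (D.exists_toENN_eq_minimalGrad hp u).choose
    set B := (D.exists_toENN_eq_minimalGrad hp v).choose
    set C := (D.exists_toENN_eq_minimalGrad hp (u + v)).choose
    have h := D.minimalGrad_add_le hp hD u.2 v.2
    rw [← a.2, ← b.2, ← Submodule.coe_add, ← c.2] at h
    filter_upwards [a.1, b.1, h, coeFn_toENN (A : X →ₘ[m] ℝ), coeFn_toENN (B : X →ₘ[m] ℝ),
      coeFn_toENN (C : X →ₘ[m] ℝ)] with x h1 h2 h3 h4 h5 h6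
    rw [h4, h5, h6, ← ENNReal.ofReal_add h1 h2] at h3
    exact (ENNReal.ofReal_le_ofReal_iff (add_nonneg h1 h2)).1 h3
  smul_eq r u := by
    have a := (D.exists_toENN_eq_minimalGrad hp u).choose_spec
    have c := (D.exists_toENN_eq_minimalGrad hp (r • u)).choose_spec
    set A := (D.exists_toENN_eq_minimalGrad hp u).choose
    set C := (D.exists_toENN_eq_minimalGrad hp (r • u)).choose
    have h := D.minimalGrad_smul hp hD r u.2
    rw [← a.2, ← Submodule.coe_smul, ← c.2] at h
    filter_upwards [a.1, c.1, h, coeFn_toENN (A : X →ₘ[m] ℝ), coeFn_toENN (C : X →ₘ[m] ℝ)]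
      with x h1 h2 h3 h4 h5
    rw [h4, h5, Real.enorm_eq_ofReal_abs, ← ENNReal.ofReal_mul (abs_nonneg _)] at h3
    exact (ENNReal.ofReal_eq_ofReal_iff h2 (mul_nonneg (abs_nonneg _) h1)).1 h3

/-- The cotangent module of a pointwise local `D`-structure exists. -/
theorem exists_isCotangentModule.{u} {X : Type u} [MetricSpace X] [MeasurableSpace X] {p : ℝ≥0∞}
    {m : Measure X} (D : DStructure p m) (hp : 1 < p) (hD : D.IsPointwiseLocal) :
    ∃ (M : Type u) (_ : NormedAddCommGroup M) (_ : NormedSpace ℝ M) (_ : Module (Linfty m) M)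
      (pnorm : M → (X →ₘ[m] ℝ≥0∞)) (d : D.sobolevClass →ₗ[ℝ] M),
      D.IsCotangentModule M pnorm d := by
  have : Fact (1 ≤ p) := ⟨hp.le⟩
  let G := D.pointwiseSeminorm hp hD
  refine ⟨G.Mod, inferInstance, inferInstance, inferInstance, _, G.diff,
    { G.isLpNormedModule with
      pnorm_d := fun u => ?_
      dense := G.dense_diff }⟩
  rw [G.pn_diff]
  exact (D.exists_toENN_eq_minimalGrad hp u).choose_spec.2

end DStructure

end AxiomaticSobolev

open AxiomaticSobolev

namespace AxiomaticSobolev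

/-! Since `|du|` is the minimal pseudo-gradient `Du` and the module norm is the `L^p` norm of the
pointwise norm, each identity for `du` reduces to an a.e. estimate of minimal pseudo-gradients.

The basic estimate is `D(φ∘u) ≤ K Du` for `K`-Lipschitz `φ`. Such a `φ` is the limit of minima of
finitely many cones `φ(q) + K|t - q|`; each cone is a maximum of two affine functions, so linearity,
lattice property and completeness put `K Du` into `D[φ∘u]` (`mem_grad_comp`). Locality refines this:
on `u⁻¹(E)` only the Lipschitz constant of `φ` on `E` counts
(`minimalGrad_comp_le_of_lipschitzOnWith`).

For a null set `N`, enclose `N` in open sets `V_n` of small measure and collapse each component of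
`V_n` to a point. The collapsed functions of `u` have zero gradient on `u⁻¹(V_n)`, gradient at most
`Du` elsewhere, and converge uniformly to `u`. In the limit `χ_{u ∉ N} Du` is a pseudo-gradient of
`u`, and minimality makes `Du` vanish on `u⁻¹(N)` (`minimalGrad_eq_zero_of_null`).

For the chain rule, cut the line into countably many pieces on which `φ` has nearly the slope bound
given by its derivative. This yields `D(φ∘u - c u) ≤ |φ'(u) - c| Du`; the points where `φ` is not
differentiable are harmless by Rademacher and the null set case. Choosing `c` as the values of a
simple function `h` gives `|d(φ∘u) - h du| ≤ |φ'(u) - h| |du|`, and simple functions are dense in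
`L^∞` (`d_comp_eq_smul`). The Leibniz rule follows from the chain rule for a truncated square by
polarization (`exists_d_mul`). -/

theorem tendsto_eLpNorm_zero_of_dominated {X : Type*} [MeasurableSpace X] {μ : Measure X}
    {p : ℝ≥0∞} (h0 : p ≠ 0) (ht : p ≠ ∞) {F : ℕ → X → ℝ} {G : X → ℝ}
    (hF : ∀ n, AEStronglyMeasurable (F n) μ) (hG : MemLp G p μ)
    (hb : ∀ n, ∀ᵐ x ∂μ, |F n x| ≤ |G x|)
    (hlim : ∀ᵐ x ∂μ, Tendsto (fun n => F n x) atTop (𝓝 0)) :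
    Tendsto (fun n => eLpNorm (F n) p μ) atTop (𝓝 0) := by
  have q0 := ENNReal.toReal_pos h0 ht
  -- Dominated convergence applies to the `p`-th powers; the outer root is restored afterwards by
  -- continuity.
  have key : Tendsto (fun n => ∫⁻ x, ‖F n x‖ₑ ^ p.toReal ∂μ) atTop (𝓝 (∫⁻ _, 0 ∂μ)) := by
    refine tendsto_lintegral_of_dominated_convergence' (fun x => ‖G x‖ₑ ^ p.toReal)
      (fun n => (hF n).enorm.pow_const _) (fun n => ?_)
      (lintegral_rpow_enorm_lt_top_of_eLpNorm_lt_top h0 ht hG.2).ne ?_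
    · filter_upwards [hb n] with x hx
      rw [Real.enorm_eq_ofReal_abs, Real.enorm_eq_ofReal_abs]
      gcongr
    · filter_upwards [hlim] with x hx
      have h1 : Tendsto (fun n => ‖F n x‖ₑ) atTop (𝓝 0) := by
        simpa [Function.comp_def] using (continuous_enorm.tendsto (0 : ℝ)).comp hx
      simpa [q0, Function.comp_def] using (ENNReal.continuous_rpow_const (y := p.toReal)).tendsto 0 |>.comp h1
  rw [lintegral_zero] at key
  have := (ENNReal.continuous_rpow_const (y := 1 / p.toReal)).tendsto 0 |>.comp key
  simp only [eLpNorm_eq_lintegral_rpow_enorm_toReal h0 ht]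
  simpa [q0, Function.comp_def] using this

/-! ### Approximation of Lipschitz functions by finite minima of cones. -/

section McShane

/-- McShane approximations from above of a `K`-Lipschitz function `φ`, built from the values of `φ`
at the points `q 0, …, q n`. -/
noncomputable def mcShane (φ : ℝ → ℝ) (K : ℝ) (q : ℕ → ℝ) : ℕ → ℝ → ℝ
  | 0, t => φ (q 0) + K * |t - q 0|
  | n + 1, t => min (mcShane φ K q n t) (φ (q (n + 1)) + K * |t - q (n + 1)|)

variable {φ : ℝ → ℝ} {K : ℝ≥0} {q : ℕ → ℝ}

theorem continuous_mcShane (φ : ℝ → ℝ) (K : ℝ) (q : ℕ → ℝ) (n : ℕ) :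
    Continuous (mcShane φ K q n) := by
  induction n with
  | zero => simp only [mcShane]; fun_prop
  | succ n ih => simp only [mcShane]; fun_prop

theorem le_mcShane (hφ : LipschitzWith K φ) (n : ℕ) (t : ℝ) : φ t ≤ mcShane φ K q n t := by
  have h : ∀ s, φ t ≤ φ s + K * |t - s| := fun s => by
    have := hφ.dist_le_mul t s
    rw [Real.dist_eq, Real.dist_eq] at this
    linarith [le_abs_self (φ t - φ s)]
  induction n with
  | zero => exact h _
  | succ n ih => exact le_min ih (h _)

theorem mcShane_le {k n : ℕ} (hkn : k ≤ n) (t : ℝ) :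
    mcShane φ K q n t ≤ φ (q k) + K * |t - q k| := by
  induction n, hkn using Nat.le_induction with
  | base =>
    cases k with
    | zero => exact le_rfl
    | succ k => exact min_le_right _ _
  | succ n _ ih => exact (min_le_left _ _).trans ih

/-- The approximation is trapped between `φ` and the cone at `q k`, which at `t` exceeds `φ` by at
most `2K|t - q k|`. With `k = 0` this is a majorant independent of `n`; with `q k` close to `t` it
gives convergence. -/
theorem abs_mcShane_sub_le (hφ : LipschitzWith K φ) {k n : ℕ} (hkn : k ≤ n) (t : ℝ) :
    |mcShane φ K q n t - φ t| ≤ 2 * K * |t - q k| := by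
  have h1 := mcShane_le (φ := φ) (K := K) (q := q) hkn t
  have h2 := hφ.dist_le_mul t (q k)
  rw [Real.dist_eq, Real.dist_eq] at h2
  rw [abs_of_nonneg (sub_nonneg.2 (le_mcShane hφ n t))]
  linarith [neg_abs_le (φ t - φ (q k))]

theorem tendsto_mcShane (hφ : LipschitzWith K φ) (hq : DenseRange q) (t : ℝ) :
    Tendsto (fun n => mcShane φ K q n t - φ t) atTop (𝓝 0) := by
  rw [Metric.tendsto_atTop]
  intro ε hε
  -- The summand `1` keeps the denominator positive when `K = 0`.
  obtain ⟨k, hk⟩ := hq.exists_dist_lt t (ε := ε / (2 * K + 1)) (by positivity)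
  refine ⟨k, fun n hn => ?_⟩
  rw [Real.dist_eq, sub_zero]
  rw [Real.dist_eq, lt_div_iff₀ (by positivity)] at hk
  have := abs_mcShane_sub_le (q := q) hφ hn t
  have := abs_nonneg (t - q k)
  linarith

end McShane

/-! ### Constants and functions of linear growth in `L^p_loc`. -/

section LpLoc

variable {X : Type*} [MetricSpace X] [MeasurableSpace X] {p : ℝ≥0∞} {m : Measure X}

theorem measure_lt_top_of_isBounded (hball : ∀ (x : X) (r : ℝ), m (Metric.ball x r) < ∞)
    {B : Set X} (hB : Bornology.IsBounded B) : m B < ∞ := by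
  rcases B.eq_empty_or_nonempty with rfl | ⟨x, -⟩
  · simp
  · obtain ⟨r, hr⟩ := hB.subset_ball x
    exact (measure_mono hr).trans_lt (hball x r)

theorem memLp_const_restrict (hball : ∀ (x : X) (r : ℝ), m (Metric.ball x r) < ∞) (c : ℝ)
    {B : Set X} (hB : Bornology.IsBounded B) : MemLp (fun _ => c) p (m.restrict B) := by
  have : IsFiniteMeasure (m.restrict B) :=
    ⟨by rw [Measure.restrict_apply_univ]; exact measure_lt_top_of_isBounded hball hB⟩
  exact memLp_const c

theorem const_mem_LpLoc (hball : ∀ (x : X) (r : ℝ), m (Metric.ball x r) < ∞) (c : ℝ) :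
    (AEEqFun.const X c : X →ₘ[m] ℝ) ∈ LpLoc p m := fun _ hB _ =>
  (memLp_congr_ae (ae_restrict_of_ae (AEEqFun.coeFn_const X c))).2 (memLp_const_restrict hball c hB)

theorem memLp_comp_restrict (hball : ∀ (x : X) (r : ℝ), m (Metric.ball x r) < ∞)
    {φ : ℝ → ℝ} (hφ : Continuous φ) {K C : ℝ} (hb : ∀ t, |φ t| ≤ K * |t| + C) {u : X →ₘ[m] ℝ}
    (hu : u ∈ LpLoc p m) {B : Set X} (hB : Bornology.IsBounded B) (hB' : MeasurableSet B) :
    MemLp (fun x => φ (u x)) p (m.restrict B) := by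
  refine ((((hu B hB hB').norm.const_mul K)).add (memLp_const_restrict hball C hB)).of_le
    (hφ.comp_aestronglyMeasurable u.aestronglyMeasurable.restrict) (Eventually.of_forall fun x => ?_)
  refine (hb (u x)).trans (le_abs_self _)

/-- Bounded sets have finite measure, so the additive constant in the growth bound is locally
`p`-integrable. Stated for linear growth rather than for Lipschitz `φ`, it applies to cones and
their minima without computing Lipschitz constants. -/
theorem comp_mem_LpLoc_of_le (hball : ∀ (x : X) (r : ℝ), m (Metric.ball x r) < ∞)
    {φ : ℝ → ℝ} (hφ : Continuous φ) {K C : ℝ} (hb : ∀ t, |φ t| ≤ K * |t| + C) {u : X →ₘ[m] ℝ}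
    (hu : u ∈ LpLoc p m) : AEEqFun.comp φ hφ u ∈ LpLoc p m := fun _ hB hB' =>
  (memLp_congr_ae (ae_restrict_of_ae (AEEqFun.coeFn_comp φ hφ u))).2
    (memLp_comp_restrict hball hφ hb hu hB hB')

theorem abs_le_of_lipschitzWith {φ : ℝ → ℝ} {K : ℝ≥0} (hφ : LipschitzWith K φ) (t : ℝ) :
    |φ t| ≤ K * |t| + |φ 0| := by
  have := hφ.dist_le_mul t 0
  rw [Real.dist_eq, Real.dist_eq, sub_zero] at this
  linarith [abs_sub_abs_le_abs_sub (φ t) (φ 0)]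

theorem comp_mem_LpLoc (hball : ∀ (x : X) (r : ℝ), m (Metric.ball x r) < ∞)
    {φ : ℝ → ℝ} {K : ℝ≥0} (hφ : LipschitzWith K φ) {u : X →ₘ[m] ℝ}
    (hu : u ∈ LpLoc p m) : AEEqFun.comp φ hφ.continuous u ∈ LpLoc p m :=
  comp_mem_LpLoc_of_le hball hφ.continuous (abs_le_of_lipschitzWith hφ) hu

end LpLoc

/-! ### Pseudo-gradients of Lipschitz functions of `u`. -/

namespace DStructure

variable {X : Type*} [MetricSpace X] [MeasurableSpace X] {p : ℝ≥0∞} {m : Measure X}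
  (D : DStructure p m)

theorem ne_zero (D' : DStructure p m) : p ≠ 0 := (zero_lt_one.trans_le D'.one_le).ne'

/-- The constant `1` has Lipschitz constant `0`. Hence adding a constant to a function does not
enlarge its pseudo-gradients. -/
theorem zero_mem_grad_one (hball : ∀ (x : X) (r : ℝ), m (Metric.ball x r) < ∞) :
    (0 : X →ₘ[m] ℝ≥0∞) ∈ D.grad (AEEqFun.const X 1) := by
  refine D.nontrivial _ (const_mem_LpLoc hball 1) (fun _ => 1) 0 (LipschitzWith.const 1)
    (fun _ => zero_le_one) (AEEqFun.coeFn_const X 1) 0 ?_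
  filter_upwards [AEEqFun.coeFn_zero (α := X) (μ := m) (β := ℝ≥0∞)] with x hx
  simp [hx]

theorem mem_grad_affine (hball : ∀ (x : X) (r : ℝ), m (Metric.ball x r) < ∞) {u : X →ₘ[m] ℝ}
    (hu : u ∈ LpLoc p m) {g h : X →ₘ[m] ℝ≥0∞} (hg : g ∈ D.grad u) (a b : ℝ)
    (hh : ∀ᵐ x ∂m, ‖a‖ₑ * g x ≤ h x) :
    h ∈ D.grad (a • u + b • AEEqFun.const X 1) := by
  refine D.upper_linear u hu _ (const_mem_LpLoc hball 1) g hg _ (D.zero_mem_grad_one hball) a b h ?_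
  filter_upwards [hh, AEEqFun.coeFn_zero (α := X) (μ := m) (β := ℝ≥0∞)] with x h1 h2
  rw [h2]; simpa using h1

/-- A cone is the maximum of the lines of slopes `K` and `-K` through its vertex. Both share the
pseudo-gradient `h`, so the lattice property returns `h ⊔ h = h`. -/
theorem mem_grad_comp_abs (hball : ∀ (x : X) (r : ℝ), m (Metric.ball x r) < ∞) {u : X →ₘ[m] ℝ}
    (hu : u ∈ LpLoc p m) {g h : X →ₘ[m] ℝ≥0∞} (hg : g ∈ D.grad u) {K : ℝ≥0} (b c : ℝ)
    (hh : ∀ᵐ x ∂m, K * g x ≤ h x)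
    (hc : Continuous fun t : ℝ => b + K * |t - c|) :
    h ∈ D.grad (AEEqFun.comp (fun t : ℝ => b + K * |t - c|) hc u) := by
  have h1 := D.mem_grad_affine hball hu hg K (b - K * c) (h := h) (by simpa using hh)
  have h2 := D.mem_grad_affine hball hu hg (-K) (b + K * c) (h := h) (by simpa using hh)
  have hm : ∀ a b : ℝ, a • u + b • AEEqFun.const X 1 ∈ LpLoc p m := fun a b =>
    add_mem (Submodule.smul_mem _ _ hu) (Submodule.smul_mem _ _ (const_mem_LpLoc hball 1))
  have h3 := (D.lattice _ (hm _ _) _ (hm _ _) h h1 h h2).1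
  rw [sup_idem] at h3
  convert h3 using 2
  have e : ∀ a b : ℝ, (a • u + b • AEEqFun.const X 1 : X →ₘ[m] ℝ) =ᵐ[m] fun x => a * u x + b := by
    intro a b
    filter_upwards [AEEqFun.coeFn_add (a • u) (b • AEEqFun.const X (1 : ℝ) : X →ₘ[m] ℝ),
      AEEqFun.coeFn_smul a u, AEEqFun.coeFn_smul b (AEEqFun.const X (1 : ℝ) : X →ₘ[m] ℝ),
      AEEqFun.coeFn_const (μ := m) X (1 : ℝ)] with x h1 h2 h3 h4
    rw [h1, Pi.add_apply, h2, h3]; simp [h4]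
  apply AEEqFun.ext
  filter_upwards [AEEqFun.coeFn_comp _ hc u, AEEqFun.coeFn_sup ((K : ℝ) • u +
    (b - K * c) • AEEqFun.const X (1 : ℝ)) ((-K : ℝ) • u + (b + K * c) • AEEqFun.const X (1 : ℝ)),
    e K (b - K * c), e (-K) (b + K * c)] with x a1 a2 a3 a4
  rw [a1, a2, a3, a4]
  simp only [Function.comp_apply]
  rcases le_total 0 (u x - c) with h | h
  · rw [abs_of_nonneg h, max_eq_left]
    · ring
    · nlinarith [mul_nonneg K.2 h]
  · rw [abs_of_nonpos h, max_eq_right]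
    · ring
    · nlinarith [mul_nonneg K.2 (neg_nonneg.2 h)]

/-- Each new cone enters through a minimum with the same `h`, so the pseudo-gradient does not grow
with `n`. Membership in `L^p_loc` is carried along because the lattice property requires it. -/
theorem mem_grad_comp_mcShane (hball : ∀ (x : X) (r : ℝ), m (Metric.ball x r) < ∞)
    {u : X →ₘ[m] ℝ} (hu : u ∈ LpLoc p m) {g h : X →ₘ[m] ℝ≥0∞} (hg : g ∈ D.grad u) {K : ℝ≥0}
    (hh : ∀ᵐ x ∂m, K * g x ≤ h x) {φ : ℝ → ℝ} (hφ : LipschitzWith K φ) (q : ℕ → ℝ) (n : ℕ) :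
    AEEqFun.comp (mcShane φ K q n) (continuous_mcShane φ K q n) u ∈ LpLoc p m ∧
    h ∈ D.grad (AEEqFun.comp (mcShane φ K q n) (continuous_mcShane φ K q n) u) := by
  have hmem : ∀ b c : ℝ, ∀ hc : Continuous fun t : ℝ => b + K * |t - c|,
      AEEqFun.comp (fun t : ℝ => b + K * |t - c|) hc u ∈ LpLoc p m := fun b c hc =>
    comp_mem_LpLoc_of_le hball hc (K := K) (C := |b| + K * |c|) (fun t => by
      have h1 := abs_add_le b (K * |t - c|)
      rw [abs_mul, abs_abs, NNReal.abs_eq] at h1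
      have h2 := mul_le_mul_of_nonneg_left (norm_sub_le t c) K.coe_nonneg
      simp only [Real.norm_eq_abs] at h2
      linarith) hu
  induction n with
  | zero => exact ⟨hmem _ _ _, D.mem_grad_comp_abs hball hu hg _ _ hh _⟩
  | succ n ih =>
    have hc : Continuous fun t : ℝ => φ (q (n + 1)) + K * |t - q (n + 1)| := by fun_prop
    have e : AEEqFun.comp (mcShane φ K q (n + 1)) (continuous_mcShane φ K q (n + 1)) u =
        AEEqFun.comp (mcShane φ K q n) (continuous_mcShane φ K q n) u ⊓
          AEEqFun.comp _ hc u := by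
      apply AEEqFun.ext
      filter_upwards [AEEqFun.coeFn_comp _ (continuous_mcShane φ K q (n + 1)) u,
        AEEqFun.coeFn_comp _ (continuous_mcShane φ K q n) u, AEEqFun.coeFn_comp _ hc u,
        AEEqFun.coeFn_inf (AEEqFun.comp (mcShane φ K q n) (continuous_mcShane φ K q n) u)
          (AEEqFun.comp _ hc u)] with x h1 h2 h3 h4
      rw [h1, h4, h2, h3]; rfl
    have h2 := (D.lattice _ ih.1 _ (hmem _ _ hc) h ih.2 h
      (D.mem_grad_comp_abs hball hu hg _ _ hh hc)).2
    rw [sup_idem, ← e] at h2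
    refine ⟨?_, h2⟩
    -- The error bound at index `0` contributes `2K(|t| + |q 0|)`, and `φ` itself contributes `K|t|
    -- + |φ 0|`.
    exact comp_mem_LpLoc_of_le hball _ (K := 2 * K + K) (C := 2 * K * |q 0| + |φ 0|) (fun t => by
      have h1 := abs_mcShane_sub_le (q := q) hφ (Nat.zero_le (n + 1)) t
      have h2 := abs_sub_abs_le_abs_sub (mcShane φ K q (n + 1) t) (φ t)
      have h3 := abs_le_of_lipschitzWith hφ t
      have h4 := mul_le_mul_of_nonneg_left (norm_sub_le t (q 0)) K.coe_nonneg
      simp only [Real.norm_eq_abs] at h4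
      linarith) hu

/-- Completeness is applied with the constant sequence `h`, so only the approximating functions have
to converge. The integrability of `h` is what that axiom demands. -/
theorem mem_grad_comp (hball : ∀ (x : X) (r : ℝ), m (Metric.ball x r) < ∞)
    {u : X →ₘ[m] ℝ} (hu : u ∈ LpLoc p m) {g h : X →ₘ[m] ℝ≥0∞} (hg : g ∈ D.grad u) {K : ℝ≥0}
    (hh : ∀ᵐ x ∂m, K * g x ≤ h x) (hfin : eLpNorm h p m < ∞) {φ : ℝ → ℝ}
    (hφ : LipschitzWith K φ) : h ∈ D.grad (AEEqFun.comp φ hφ.continuous u) := by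
  let q := TopologicalSpace.denseSeq ℝ
  have hq : DenseRange q := TopologicalSpace.denseRange_denseSeq ℝ
  have H := fun n => D.mem_grad_comp_mcShane hball hu hg hh hφ q n
  refine D.complete _ (fun _ => h) (fun n => (H n).1) (fun _ => hfin) (fun n => (H n).2) _
    (comp_mem_LpLoc hball hφ hu) h hfin (fun B hB hB' => ?_) (by simp)
  have e : ∀ n, (fun x => AEEqFun.comp _ (continuous_mcShane φ K q n) u x -
      AEEqFun.comp φ hφ.continuous u x) =ᵐ[m.restrict B]
      fun x => mcShane φ K q n (u x) - φ (u x) := by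
    intro n
    refine ae_restrict_of_ae ?_
    filter_upwards [AEEqFun.coeFn_comp _ (continuous_mcShane φ K q n) u,
      AEEqFun.coeFn_comp _ hφ.continuous u] with x h1 h2
    rw [h1, h2]; rfl
  simp only [fun n => eLpNorm_congr_ae (p := p) (e n)]
  have hm : AEStronglyMeasurable u (m.restrict B) := u.aestronglyMeasurable.restrict
  refine tendsto_eLpNorm_zero_of_dominated D.ne_zero D.ne_top
    -- The error bound for `k = 0` dominates all approximations at once.
    (G := fun x => 2 * K * (u x - q 0)) (fun n => ?_)
    (((hu B hB hB').sub (memLp_const_restrict hball (q 0) hB)).const_mul (2 * (K : ℝ)))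
    (fun n => Eventually.of_forall fun x => ?_)
    (Eventually.of_forall fun x => tendsto_mcShane hφ hq (u x))
  · exact ((continuous_mcShane φ K q n).comp_aestronglyMeasurable hm).sub
      (hφ.continuous.comp_aestronglyMeasurable hm)
  · refine (abs_mcShane_sub_le hφ (Nat.zero_le n) (u x)).trans ?_
    rw [abs_mul, abs_of_nonneg (by positivity : (0 : ℝ) ≤ 2 * K)]

end DStructure

theorem eLpNorm_mk_lt_top_of_le_mul {X : Type*} [MeasurableSpace X] {p : ℝ≥0∞} {m : Measure X}
    (K : ℝ≥0) {g : X →ₘ[m] ℝ≥0∞} (hg : eLpNorm g p m < ∞)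
    {f : X → ℝ≥0∞} (hf : Measurable f) (hfg : ∀ᵐ x ∂m, f x ≤ K * g x) :
    eLpNorm (AEEqFun.mk f hf.aestronglyMeasurable : X →ₘ[m] ℝ≥0∞) p m < ∞ := by
  refine (eLpNorm_le_nnreal_smul_eLpNorm_of_ae_le_mul' (c := K) (g := g) ?_ p).trans_lt
    (ENNReal.mul_lt_top ENNReal.coe_lt_top hg)
  filter_upwards [AEEqFun.coeFn_mk f (hf.aestronglyMeasurable (μ := m)), hfg] with x h1 h2
  rw [h1]; exact h2

/-! ### Collapsing an open set of small measure. -/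

/-- The antiderivative of the indicator function of the complement of `V`. -/
noncomputable def collapse (V : Set ℝ) (t : ℝ) : ℝ := ∫ s in (0 : ℝ)..t, Vᶜ.indicator 1 s

section Collapse

variable {V : Set ℝ}

theorem intervalIntegrable_indicator_one (hV : MeasurableSet V) (a b : ℝ) :
    IntervalIntegrable (V.indicator (1 : ℝ → ℝ)) volume a b :=
  ⟨(integrable_const (1 : ℝ)).indicator hV, (integrable_const (1 : ℝ)).indicator hV⟩

theorem collapse_sub (hV : MeasurableSet V) (s t : ℝ) :
    collapse V t - collapse V s = ∫ r in s..t, Vᶜ.indicator 1 r :=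
  intervalIntegral.integral_interval_sub_left (intervalIntegrable_indicator_one hV.compl _ _)
    (intervalIntegrable_indicator_one hV.compl _ _)

theorem lipschitzWith_collapse (hV : MeasurableSet V) : LipschitzWith 1 (collapse V) := by
  refine LipschitzWith.of_dist_le_mul fun t s => ?_
  rw [Real.dist_eq, collapse_sub hV, Real.dist_eq, NNReal.coe_one, ← Real.norm_eq_abs]
  refine intervalIntegral.norm_integral_le_of_norm_le_const fun r _ => ?_
  by_cases hr : r ∈ Vᶜ
  · simp [indicator_of_mem hr]
  · simp [indicator_of_notMem hr]

/-- The integrand vanishes on `V`, so the antiderivative is flat on every interval inside `V`. -/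
theorem collapse_eq_of_uIcc_subset (hV : MeasurableSet V) {s t : ℝ} (h : uIcc s t ⊆ V) :
    collapse V t = collapse V s := by
  rw [← sub_eq_zero, collapse_sub hV, intervalIntegral.integral_congr (g := fun _ => 0)
    (fun r hr => indicator_of_notMem (not_not.2 (h hr)) _)]
  simp

/-- The difference from the identity is, up to sign, the integral of the indicator of `V` from `0`
to `t`. The bound is uniform in `t`, so small `V` gives uniform approximation of the identity. -/
theorem abs_collapse_sub_le (hV : MeasurableSet V) (hfin : volume V ≠ ∞) (t : ℝ) :
    |collapse V t - t| ≤ (volume V).toReal := by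
  have h : collapse V t - t = -∫ r in (0 : ℝ)..t, V.indicator 1 r := by
    have h1 : t = ∫ _ in (0 : ℝ)..t, (1 : ℝ) := by simp
    have h2 : collapse V t - t = collapse V t - ∫ _ in (0 : ℝ)..t, (1 : ℝ) := by rw [← h1]
    rw [h2, collapse, ← intervalIntegral.integral_sub (intervalIntegrable_indicator_one hV.compl _ _)
      intervalIntegrable_const, ← intervalIntegral.integral_neg]
    refine intervalIntegral.integral_congr fun r _ => ?_
    by_cases hr : r ∈ V <;> simp [hr]
  rw [h, abs_neg, ← Real.norm_eq_abs]
  refine intervalIntegral.norm_integral_le_integral_norm_uIoc.trans ?_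
  have hint : Integrable (V.indicator (1 : ℝ → ℝ)) :=
    (integrable_indicator_iff hV).2 (by
      exact integrableOn_const hfin)
  calc ∫ r in uIoc 0 t, ‖V.indicator (1 : ℝ → ℝ) r‖
      ≤ ∫ r, ‖V.indicator (1 : ℝ → ℝ) r‖ :=
        setIntegral_le_integral hint.norm (Eventually.of_forall fun _ => norm_nonneg _)
    _ = ∫ r, V.indicator (1 : ℝ → ℝ) r := by
        refine integral_congr_ae (Eventually.of_forall fun r => ?_)
        exact Real.norm_of_nonneg (indicator_nonneg (fun _ _ => zero_le_one) r)
    _ = (volume V).toReal := by rw [integral_indicator_one hV]; rfl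

end Collapse

/-! ### Locality of the minimal pseudo-gradient and null sets of values. -/

namespace DStructure

variable {X : Type*} [MetricSpace X] [MeasurableSpace X] {p : ℝ≥0∞} {m : Measure X}
  (D : DStructure p m)

theorem mem_sobolevClass_of_mem_grad {u : X →ₘ[m] ℝ} (hu : u ∈ LpLoc p m) {g : X →ₘ[m] ℝ≥0∞}
    (hg : g ∈ D.grad u) (hfin : eLpNorm g p m < ∞) : u ∈ D.sobolevClass := by
  refine ⟨hu, D.energy_univ_lt_top.2 ⟨g, hg, ?_⟩⟩
  rw [lintegral_rpow_eq_eLpNorm D.ne_zero D.ne_top]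
  exact ENNReal.rpow_lt_top_of_nonneg D.toReal_pos.le hfin.ne

theorem mem_grad_of_le {u : X →ₘ[m] ℝ} (hu : u ∈ LpLoc p m) {g h : X →ₘ[m] ℝ≥0∞}
    (hg : g ∈ D.grad u) (hh : ∀ᵐ x ∂m, g x ≤ h x) : h ∈ D.grad u := by
  have := D.upper_linear u hu u hu g hg g hg 1 0 h (by simpa using hh)
  simpa using this

theorem mk_mul_minimalGrad_mem_grad_comp (hp : 1 < p)
    (hball : ∀ (x : X) (r : ℝ), m (Metric.ball x r) < ∞) {u : X →ₘ[m] ℝ} (hu : u ∈ D.sobolevClass)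
    {φ : ℝ → ℝ} {K : ℝ≥0} (hφ : LipschitzWith K φ) :
    (AEEqFun.mk (fun x => K * D.minimalGrad u x)
      ((D.minimalGrad u).measurable.const_mul _).aestronglyMeasurable : X →ₘ[m] ℝ≥0∞) ∈
        D.grad (AEEqFun.comp φ hφ.continuous u) :=
  D.mem_grad_comp hball hu.1 (D.minimalGrad_spec hp hu).1
    (by
      filter_upwards [AEEqFun.coeFn_mk _ (((D.minimalGrad u).measurable.const_mul
        (K : ℝ≥0∞)).aestronglyMeasurable (μ := m))] with x hx
      rw [hx])
    (eLpNorm_mk_lt_top_of_le_mul K (D.eLpNorm_minimalGrad_lt_top hp hu)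
      ((D.minimalGrad u).measurable.const_mul _)
      (Eventually.of_forall fun _ => le_rfl)) hφ

theorem comp_mem_sobolevClass (hp : 1 < p)
    (hball : ∀ (x : X) (r : ℝ), m (Metric.ball x r) < ∞) {u : X →ₘ[m] ℝ} (hu : u ∈ D.sobolevClass)
    {φ : ℝ → ℝ} {K : ℝ≥0} (hφ : LipschitzWith K φ) :
    AEEqFun.comp φ hφ.continuous u ∈ D.sobolevClass :=
  D.mem_sobolevClass_of_mem_grad (comp_mem_LpLoc hball hφ hu.1)
    (D.mk_mul_minimalGrad_mem_grad_comp hp hball hu hφ)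
    (eLpNorm_mk_lt_top_of_le_mul K (D.eLpNorm_minimalGrad_lt_top hp hu)
      ((D.minimalGrad u).measurable.const_mul _)
      (Eventually.of_forall fun _ => le_rfl))

theorem minimalGrad_comp_le (hp : 1 < p)
    (hball : ∀ (x : X) (r : ℝ), m (Metric.ball x r) < ∞) (hD : D.IsPointwiseLocal)
    {u : X →ₘ[m] ℝ} (hu : u ∈ D.sobolevClass) {φ : ℝ → ℝ} {K : ℝ≥0} (hφ : LipschitzWith K φ) :
    ∀ᵐ x ∂m, D.minimalGrad (AEEqFun.comp φ hφ.continuous u) x ≤ K * D.minimalGrad u x := by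
  filter_upwards [hD.minimalGrad_le _ (D.comp_mem_sobolevClass hp hball hu hφ) _
    (D.mk_mul_minimalGrad_mem_grad_comp hp hball hu hφ), AEEqFun.coeFn_mk _
      (((D.minimalGrad u).measurable.const_mul (K : ℝ≥0∞)).aestronglyMeasurable (μ := m))]
    with x h1 h2
  rwa [h2] at h1

/-- The energy on `B` is an infimum over all pseudo-gradients, a priori with other near-minimizers
than on the whole space. Being a.e. below each of them, the minimal one attains the infimum on `B`
as well. -/
theorem minimalGrad_eq_zero_of_ae_eq_const (hD : D.IsPointwiseLocal) {u : X →ₘ[m] ℝ}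
    (hu : u ∈ D.sobolevClass) {B : Set X} (hB : MeasurableSet B) {c : ℝ}
    (h : ∀ᵐ x ∂m, x ∈ B → u x = c) : ∀ᵐ x ∂m, x ∈ B → D.minimalGrad u x = 0 := by
  have h1 : ∫⁻ x in B, (D.minimalGrad u x) ^ p.toReal ∂m = 0 := by
    refine le_antisymm ?_ zero_le
    rw [← hD.energy_eq_zero u hu B c hB h]
    refine le_iInf₂ fun g hg => lintegral_mono_ae (ae_restrict_of_ae ?_)
    filter_upwards [hD.minimalGrad_le u hu g hg] with x hx
    exact ENNReal.rpow_le_rpow hx D.toReal_pos.le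
  rw [lintegral_eq_zero_iff ((D.minimalGrad u).measurable.pow_const _), EventuallyEq,
    ae_restrict_iff' hB] at h1
  filter_upwards [h1] with x hx hxB
  exact (ENNReal.rpow_eq_zero_iff_of_pos D.toReal_pos).1 (hx hxB)

/-- Subadditivity bounds `Du` by `D(u - v) + Dv`, and `u - v` is constantly zero on `B`. -/
theorem minimalGrad_le_of_ae_eq (hp : 1 < p) (hD : D.IsPointwiseLocal) {u v : X →ₘ[m] ℝ}
    (hu : u ∈ D.sobolevClass) (hv : v ∈ D.sobolevClass) {B : Set X} (hB : MeasurableSet B)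
    (h : ∀ᵐ x ∂m, x ∈ B → u x = v x) :
    ∀ᵐ x ∂m, x ∈ B → D.minimalGrad u x ≤ D.minimalGrad v x := by
  have h1 := D.minimalGrad_add_le hp hD (sub_mem hu hv) hv
  rw [sub_add_cancel] at h1
  filter_upwards [h1, D.minimalGrad_eq_zero_of_ae_eq_const hD (sub_mem hu hv) hB (c := 0) (by
    filter_upwards [h, AEEqFun.coeFn_sub u v] with x h2 h3 hx
    rw [h3, Pi.sub_apply, h2 hx, sub_self])] with x h2 h3 hx
  rwa [h3 hx, zero_add] at h2

/-- Extend the restriction of `φ` to `E` to an `L`-Lipschitz function on the line; it gives the same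
composition on `u⁻¹(E)`, so locality transfers its global bound. -/
theorem minimalGrad_comp_le_of_lipschitzOnWith (hp : 1 < p)
    (hball : ∀ (x : X) (r : ℝ), m (Metric.ball x r) < ∞) (hD : D.IsPointwiseLocal)
    {u : X →ₘ[m] ℝ} (hu : u ∈ D.sobolevClass) {φ : ℝ → ℝ} {K : ℝ≥0} (hφ : LipschitzWith K φ)
    {L : ℝ≥0} {E : Set ℝ} (hE : MeasurableSet E) (hL : LipschitzOnWith L φ E) :
    ∀ᵐ x ∂m, u x ∈ E →
      D.minimalGrad (AEEqFun.comp φ hφ.continuous u) x ≤ L * D.minimalGrad u x := by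
  obtain ⟨ψ, hψ, hEq⟩ := hL.extend_real
  filter_upwards [D.minimalGrad_comp_le hp hball hD hu hψ, D.minimalGrad_le_of_ae_eq hp hD
    (D.comp_mem_sobolevClass hp hball hu hφ) (D.comp_mem_sobolevClass hp hball hu hψ)
    (u.measurable hE) (by
      filter_upwards [AEEqFun.coeFn_comp φ hφ.continuous u, AEEqFun.coeFn_comp ψ hψ.continuous u]
        with x h1 h2 hx
      rw [h1, h2]; exact hEq hx)] with x h1 h2 hx
  exact (h2 hx).trans h1

/-- On an interval inside `V` the collapse is constant, hence has Lipschitz constant `0` there.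
Rational intervals suffice to cover `V`, and their countability keeps the exceptional set null. -/
theorem minimalGrad_comp_eq_zero_of_isOpen (hp : 1 < p)
    (hball : ∀ (x : X) (r : ℝ), m (Metric.ball x r) < ∞) (hD : D.IsPointwiseLocal)
    {u : X →ₘ[m] ℝ} (hu : u ∈ D.sobolevClass) {V : Set ℝ} (hV : IsOpen V) :
    ∀ᵐ x ∂m, u x ∈ V → D.minimalGrad
      (AEEqFun.comp (collapse V) (lipschitzWith_collapse hV.measurableSet).continuous u) x = 0 := by
  have h : ∀ a b : ℚ, Ioo (a : ℝ) b ⊆ V → ∀ᵐ x ∂m, u x ∈ Ioo (a : ℝ) b → D.minimalGrad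
      (AEEqFun.comp (collapse V) (lipschitzWith_collapse hV.measurableSet).continuous u) x = 0 := by
    intro a b hab
    have hL : LipschitzOnWith 0 (collapse V) (Ioo (a : ℝ) b) :=
      LipschitzOnWith.of_dist_le_mul fun s hs t ht => by
        rw [collapse_eq_of_uIcc_subset hV.measurableSet
          ((ordConnected_Ioo.uIcc_subset ht hs).trans hab)]
        simp
    filter_upwards [D.minimalGrad_comp_le_of_lipschitzOnWith hp hball hD hu
      (lipschitzWith_collapse hV.measurableSet) measurableSet_Ioo hL] with x hx hxI
    simpa using hx hxI
  have h' : ∀ᵐ x ∂m, ∀ a b : ℚ, Ioo (a : ℝ) b ⊆ V → u x ∈ Ioo (a : ℝ) b → D.minimalGrad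
      (AEEqFun.comp (collapse V) (lipschitzWith_collapse hV.measurableSet).continuous u) x = 0 := by
    simp only [ae_all_iff]
    exact h
  filter_upwards [h'] with x hx hxV
  obtain ⟨a, b, hmem, hsub⟩ : ∃ a b : ℚ, u x ∈ Ioo (a : ℝ) b ∧ Ioo (a : ℝ) b ⊆ V := by
    obtain ⟨s, hs, h1, h2⟩ :=
      Real.isTopologicalBasis_Ioo_rat.exists_subset_of_mem_open hxV hV
    simp only [mem_iUnion, mem_singleton_iff] at hs
    obtain ⟨a, b, -, rfl⟩ := hs
    exact ⟨a, b, h1, h2⟩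
  exact hx a b hsub hmem

/-- The competitor is `Du` cut off on `u⁻¹(N)`. It is a pseudo-gradient of every collapsed function:
these have zero gradient over `V n ⊇ N`, and gradient at most `Du` elsewhere as the collapses are
`1`-Lipschitz. Completeness passes this to `u`. -/
theorem minimalGrad_eq_zero_of_null (hp : 1 < p)
    (hball : ∀ (x : X) (r : ℝ), m (Metric.ball x r) < ∞) (hD : D.IsPointwiseLocal)
    {u : X →ₘ[m] ℝ} (hu : u ∈ D.sobolevClass) {N : Set ℝ} (hN : MeasurableSet N)
    (hN0 : volume N = 0) : ∀ᵐ x ∂m, u x ∈ N → D.minimalGrad u x = 0 := by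
  have hV : ∀ n : ℕ, ∃ V ⊇ N, IsOpen V ∧ volume V < ENNReal.ofReal (1 / (n + 1)) := fun n =>
    N.exists_isOpen_lt_of_lt _ (by rw [hN0]; simp; positivity)
  choose V hNV hVo hVlt using hV
  have hf : Measurable ((u ⁻¹' N)ᶜ.indicator (D.minimalGrad u)) :=
    (D.minimalGrad u).measurable.indicator (u.measurable hN).compl
  have hfg := AEEqFun.coeFn_mk _ (hf.aestronglyMeasurable (μ := m))
  set g : X →ₘ[m] ℝ≥0∞ := AEEqFun.mk _ hf.aestronglyMeasurable with hg
  have hfin : eLpNorm g p m < ∞ := eLpNorm_mk_lt_top_of_le_mul 1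
    (D.eLpNorm_minimalGrad_lt_top hp hu) hf (Eventually.of_forall fun x => by
      rw [ENNReal.coe_one, one_mul]; exact indicator_le_self' (fun _ _ => zero_le) x)
  have hL := fun n => lipschitzWith_collapse (hVo n).measurableSet
  have hmem : ∀ n, g ∈ D.grad (AEEqFun.comp _ (hL n).continuous u) := fun n => by
    have hS := D.comp_mem_sobolevClass hp hball hu (hL n)
    refine D.mem_grad_of_le hS.1 (D.minimalGrad_spec hp hS).1 ?_
    filter_upwards [hfg, D.minimalGrad_comp_eq_zero_of_isOpen hp hball hD hu (hVo n),
      D.minimalGrad_comp_le hp hball hD hu (hL n)] with x h1 h2 h3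
    rw [h1]
    by_cases hx : u x ∈ N
    · rw [h2 (hNV n hx)]; exact zero_le
    · rw [indicator_of_mem (by exact hx)]
      simpa using h3
  have hgu : g ∈ D.grad u := by
    refine D.complete _ (fun _ => g) (fun n => comp_mem_LpLoc hball (hL n) hu.1) (fun _ => hfin)
      hmem u hu.1 g hfin (fun B hB hB' => ?_) (by simp)
    have hb : ∀ n, ∀ᵐ x ∂m.restrict B, |AEEqFun.comp _ (hL n).continuous u x - u x|
        ≤ 1 / ((n : ℝ) + 1) := fun n => by
      refine ae_restrict_of_ae ?_
      filter_upwards [AEEqFun.coeFn_comp _ (hL n).continuous u] with x hx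
      rw [hx]
      exact (abs_collapse_sub_le (hVo n).measurableSet (hVlt n).ne_top _).trans
        (ENNReal.toReal_le_of_le_ofReal (by positivity) (hVlt n).le)
    -- The uniform error is below `1 / (n + 1) ≤ 1`, and the constant `1` is `p`-integrable on the
    -- bounded set `B`.
    refine tendsto_eLpNorm_zero_of_dominated D.ne_zero D.ne_top (G := fun _ => 1)
      (fun n => ((AEEqFun.aestronglyMeasurable _).sub u.aestronglyMeasurable).restrict)
      (memLp_const_restrict hball 1 hB) (fun n => ?_) ?_
    · filter_upwards [hb n] with x hx
      refine hx.trans ?_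
      rw [abs_one, div_le_one (by positivity)]
      linarith [n.cast_nonneg (α := ℝ)]
    · filter_upwards [ae_all_iff.2 hb] with x hx
      exact squeeze_zero_norm hx tendsto_one_div_add_atTop_nhds_zero_nat
  filter_upwards [hD.minimalGrad_le u hu g hgu, hfg] with x h1 h2 hx
  rw [h2, indicator_of_notMem (by simpa using hx)] at h1
  exact le_antisymm h1 zero_le

end DStructure

/-! ### Decomposition of the line by slope bounds. -/

section Slope

/-- The points `t` at which `φ` has slope at most `r` at scales below `δ`. -/
def slopeSet (φ : ℝ → ℝ) (r δ : ℝ) : Set ℝ := {t | ∀ s, |s - t| < δ → |φ s - φ t| ≤ r * |s - t|}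

/-- For fixed `s` the defining implication is a union of two closed conditions, thanks to the strict
inequality in its premise. Closedness supplies the measurability that the localized Lipschitz bound
asks for. -/
theorem isClosed_slopeSet {φ : ℝ → ℝ} (hφ : Continuous φ) (r δ : ℝ) :
    IsClosed (slopeSet φ r δ) := by
  have h : slopeSet φ r δ = ⋂ s, ({t | δ ≤ |s - t|} ∪ {t | |φ s - φ t| ≤ r * |s - t|}) := by
    ext t
    simp only [slopeSet, mem_ofPred_eq, mem_iInter, mem_union, ← not_lt, ← imp_iff_not_or]
  rw [h]
  exact isClosed_iInter fun s => (isClosed_le (by fun_prop) (by fun_prop)).union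
    (isClosed_le (by fun_prop) (by fun_prop))

/-- Two points of a ball of radius `δ / 2` lie within the scale `δ` on which the slope is
controlled. -/
theorem lipschitzOnWith_slopeSet_inter_ball (φ : ℝ → ℝ) (r : ℝ≥0) (δ c : ℝ) :
    LipschitzOnWith r φ (slopeSet φ r δ ∩ Metric.ball c (δ / 2)) := by
  refine LipschitzOnWith.of_dist_le_mul fun s hs t ht => ?_
  rw [Real.dist_eq, Real.dist_eq]
  refine ht.1 s ?_
  have h1 := hs.2
  have h2 := ht.2
  rw [Metric.mem_ball] at h1 h2
  rw [← Real.dist_eq]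
  linarith [dist_triangle_right s t c]

theorem exists_mem_slopeSet {φ : ℝ → ℝ} {t : ℝ} (hφ : DifferentiableAt ℝ φ t) {r : ℝ}
    (hr : |deriv φ t| < r) : ∃ k : ℕ, t ∈ slopeSet φ r (1 / (k + 1)) := by
  have h := (hφ.hasDerivAt.hasDerivWithinAt (s := univ)).limsup_norm_slope_le hr
  rw [nhdsWithin_univ, Metric.eventually_nhds_iff] at h
  obtain ⟨ε, hε, h⟩ := h
  obtain ⟨k, hk⟩ := exists_nat_one_div_lt hε
  refine ⟨k, fun s hs => ?_⟩
  rcases eq_or_ne s t with rfl | hst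
  · simp
  · have h1 := h (y := s) (by rw [Real.dist_eq]; exact hs.trans hk)
    rw [Real.norm_eq_abs, Real.norm_eq_abs,
      inv_mul_lt_iff₀ (abs_pos.2 (sub_ne_zero.2 hst)), mul_comm] at h1
    exact h1.le

end Slope

theorem comp_sub_mul_eq {X : Type*} [MeasurableSpace X] {m : Measure X} {φ : ℝ → ℝ} (hφ : Continuous φ) (c : ℝ)
    (hc : Continuous fun t => φ t - c * t) (u : X →ₘ[m] ℝ) :
    AEEqFun.comp (fun t => φ t - c * t) hc u = AEEqFun.comp φ hφ u - c • u := by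
  apply AEEqFun.ext
  filter_upwards [AEEqFun.coeFn_comp _ hc u, AEEqFun.coeFn_comp _ hφ u, AEEqFun.coeFn_smul c u,
    AEEqFun.coeFn_sub (AEEqFun.comp φ hφ u) (c • u)] with x h1 h2 h3 h4
  rw [h1, h4, Pi.sub_apply, h2, h3]; rfl

theorem exists_linfty_eq_deriv {X : Type*} [MeasurableSpace X] {m : Measure X} (u : X →ₘ[m] ℝ) {φ : ℝ → ℝ} {K : ℝ≥0}
    (hφ : LipschitzWith K φ) :
    ∃ f : Linfty m, f =ᵐ[m] fun x => deriv φ (u x) := by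
  have h : MemLp (fun x => deriv φ (u x)) ∞ m :=
    -- The bound by `K` holds everywhere, because `deriv` is `0` where `φ` is not differentiable.
    memLp_top_of_bound ((measurable_deriv φ).comp u.measurable).aestronglyMeasurable K
      (Eventually.of_forall fun x => norm_deriv_le_of_lipschitz hφ)
  exact ⟨h.toLp, h.coeFn_toLp⟩

/-! ### The pointwise estimate behind the chain rule. -/

namespace DStructure

variable {X : Type*} [MetricSpace X] [MeasurableSpace X] {p : ℝ≥0∞} {m : Measure X}
  (D : DStructure p m)

theorem minimalGrad_ae_lt_top (hp : 1 < p) {u : X →ₘ[m] ℝ} (hu : u ∈ D.sobolevClass) :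
    ∀ᵐ x ∂m, D.minimalGrad u x < ∞ := by
  have h := (D.eLpNorm_minimalGrad_lt_top hp hu).ne
  have h1 : ∫⁻ x, D.minimalGrad u x ^ p.toReal ∂m ≠ ∞ := by
    rw [lintegral_rpow_eq_eLpNorm D.ne_zero D.ne_top]
    exact ENNReal.rpow_ne_top_of_nonneg D.toReal_pos.le h
  filter_upwards [ae_lt_top ((D.minimalGrad u).measurable.pow_const _) h1] with x hx
  exact (ENNReal.rpow_lt_top_iff_of_pos D.toReal_pos).1 hx

/-- A point of differentiability lies, for each rational slope above `|φ'|`, in a small piece of the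
line on which `φ` is Lipschitz with that constant. Only countably many pieces occur, so the
localized bound holds on all of them off one null set; the rational slope then decreases to `|φ'|`.
-/
theorem minimalGrad_comp_le_deriv (hp : 1 < p)
    (hball : ∀ (x : X) (r : ℝ), m (Metric.ball x r) < ∞) (hD : D.IsPointwiseLocal)
    {u : X →ₘ[m] ℝ} (hu : u ∈ D.sobolevClass) {φ : ℝ → ℝ} {K : ℝ≥0} (hφ : LipschitzWith K φ) :
    ∀ᵐ x ∂m, DifferentiableAt ℝ φ (u x) →
      D.minimalGrad (AEEqFun.comp φ hφ.continuous u) x ≤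
        ‖deriv φ (u x)‖ₑ * D.minimalGrad u x := by
  have h : ∀ᵐ x ∂m, ∀ (q : ℚ) (k : ℕ) (c : ℚ),
      u x ∈ slopeSet φ (q : ℝ).toNNReal (1 / (k + 1)) ∩ Metric.ball (c : ℝ) (1 / (k + 1) / 2) →
      D.minimalGrad (AEEqFun.comp φ hφ.continuous u) x ≤
        (q : ℝ).toNNReal * D.minimalGrad u x := by
    simp only [ae_all_iff]
    exact fun q k c => D.minimalGrad_comp_le_of_lipschitzOnWith hp hball hD hu hφ
      ((isClosed_slopeSet hφ.continuous _ _).measurableSet.inter measurableSet_ball)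
      (lipschitzOnWith_slopeSet_inter_ball φ _ _ _)
  filter_upwards [h, D.minimalGrad_ae_lt_top hp hu] with x hx hfin hd
  -- Finiteness of the gradient matters when the derivative is `0`: `r * ∞` does not tend to `0 * ∞
  -- = 0`.
  have hlim : Tendsto (fun r : ℝ≥0 => (r : ℝ≥0∞) * D.minimalGrad u x)
      (𝓝[>] ‖deriv φ (u x)‖₊) (𝓝 (‖deriv φ (u x)‖ₑ * D.minimalGrad u x)) :=
    ENNReal.Tendsto.mul_const (ENNReal.tendsto_coe.2 nhdsWithin_le_nhds) (Or.inr hfin.ne)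
  refine ge_of_tendsto hlim ?_
  filter_upwards [self_mem_nhdsWithin] with r hr
  obtain ⟨q, -, hq1, hq2⟩ := (NNReal.lt_iff_exists_rat_btwn _ _).1 hr
  obtain ⟨k, hk⟩ := exists_mem_slopeSet hd (r := (q : ℝ).toNNReal) (NNReal.coe_lt_coe.2 hq1)
  obtain ⟨c, hc⟩ := Rat.denseRange_cast.exists_dist_lt (u x)
    (ε := 1 / ((k : ℝ) + 1) / 2) (by positivity)
  refine (hx q k c ⟨hk, hc⟩).trans ?_
  gcongr

/-- The left side is the gradient of `ψ∘u` with `ψ(t) = φ(t) - c t`, whose derivative is `φ' - c`.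
Where `φ` is not differentiable at `u x`, Rademacher and the null set result give `Du = 0`, so the
value of `f` there is immaterial. -/
theorem minimalGrad_comp_sub_smul_le (hp : 1 < p)
    (hball : ∀ (x : X) (r : ℝ), m (Metric.ball x r) < ∞) (hD : D.IsPointwiseLocal)
    {u : X →ₘ[m] ℝ} (hu : u ∈ D.sobolevClass) {φ : ℝ → ℝ} {K : ℝ≥0} (hφ : LipschitzWith K φ)
    {f : X → ℝ} (hf : ∀ᵐ x ∂m, DifferentiableAt ℝ φ (u x) → f x = deriv φ (u x)) (c : ℝ) :
    ∀ᵐ x ∂m, D.minimalGrad (AEEqFun.comp φ hφ.continuous u - c • u) x ≤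
      ‖f x - c‖ₑ * D.minimalGrad u x := by
  have hψ : LipschitzWith (K + ‖c‖₊) fun t => φ t - c * t := hφ.sub (lipschitzWith_smul c)
  rw [← comp_sub_mul_eq hφ.continuous c hψ.continuous]
  have hN : volume {t | DifferentiableAt ℝ φ t}ᶜ = 0 := hφ.ae_differentiableAt_real
  filter_upwards [hf, D.minimalGrad_comp_le_deriv hp hball hD hu hψ,
    D.minimalGrad_comp_le hp hball hD hu hψ, D.minimalGrad_eq_zero_of_null hp hball hD hu
      (measurableSet_of_differentiableAt ℝ φ).compl hN] with x h1 h2 h3 h4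
  by_cases hx : DifferentiableAt ℝ φ (u x)
  · have hd : HasDerivAt (fun t => φ t - c * t) (deriv φ (u x) - c) (u x) := by
      simpa using hx.hasDerivAt.fun_sub ((hasDerivAt_id (u x)).const_mul c)
    have := h2 hd.differentiableAt
    rwa [hd.deriv, ← h1 hx] at this
  · rw [h4 hx, mul_zero] at h3
    exact h3.trans zero_le

end DStructure

/-! ### Norm estimates and locality in normed modules. -/

section NormedModule

variable {X : Type*} [MeasurableSpace X] {p : ℝ≥0∞} {m : Measure X} {M : Type*}
  [NormedAddCommGroup M] [NormedSpace ℝ M] [Module (Linfty m) M] {pnorm : M → (X →ₘ[m] ℝ≥0∞)}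

theorem Linfty.ae_enorm_le (f : Linfty m) : ∀ᵐ x ∂m, ‖f x‖ₑ ≤ ‖f‖ₑ := by
  have h := ae_le_eLpNormEssSup (f := f) (μ := m)
  rwa [← eLpNorm_exponent_top, ← Lp.enorm_def] at h

namespace IsLpNormedModule

theorem norm_le_of_ae_le (hM : IsLpNormedModule p m M pnorm) {v w : M} {C : ℝ≥0}
    (h : ∀ᵐ x ∂m, pnorm v x ≤ C * pnorm w x) : ‖v‖ ≤ C * ‖w‖ := by
  have h1 : ‖v‖ₑ ≤ C * ‖w‖ₑ := by
    rw [hM.enorm_eq, hM.enorm_eq]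
    exact eLpNorm_le_nnreal_smul_eLpNorm_of_ae_le_mul' h p
  rw [enorm_eq_nnnorm, enorm_eq_nnnorm] at h1
  have h2 : ‖v‖₊ ≤ C * ‖w‖₊ := by exact_mod_cast h1
  exact_mod_cast h2

theorem norm_smul_le' (hM : IsLpNormedModule p m M pnorm) (f : Linfty m) (v : M) :
    ‖f • v‖ ≤ ‖f‖ * ‖v‖ := by
  refine hM.norm_le_of_ae_le (C := ‖f‖₊) ?_
  filter_upwards [hM.pnorm_smul f v, Linfty.ae_enorm_le f] with x h1 h2
  rw [h1]
  gcongr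
  exact h2

theorem eq_zero_of_ae (hM : IsLpNormedModule p m M pnorm) {v : M} (h : ∀ᵐ x ∂m, pnorm v x = 0) :
    v = 0 := by
  have := hM.norm_le_of_ae_le (v := v) (w := v) (C := 0) (by
    filter_upwards [h] with x hx
    simp [hx])
  simpa using this

/-- The pointwise norm is local because multiplying by the characteristic function of `B` does not
change it on `B`. -/
theorem pnorm_eq_of_chi_smul_eq (hM : IsLpNormedModule p m M pnorm) {B : Set X}
    (hB : MeasurableSet B) {v w : M} (h : Linfty.chi m B hB • v = Linfty.chi m B hB • w) :
    ∀ᵐ x ∂m, x ∈ B → pnorm v x = pnorm w x := by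
  have h1 := hM.pnorm_smul (Linfty.chi m B hB) v
  rw [h] at h1
  filter_upwards [h1, hM.pnorm_smul (Linfty.chi m B hB) w, Linfty.coeFn_chi (m := m) B hB]
    with x h1 h2 h3 hx
  rw [h1, h3, indicator_of_mem hx] at h2
  simpa using h2

/-- This freezes a coefficient: where `f` is constant, its action may be replaced by a real scalar,
with which the linear map `d` commutes. -/
theorem pnorm_sub_smul_eq (hM : IsLpNormedModule p m M pnorm) {B : Set X} (hB : MeasurableSet B)
    {f : Linfty m} {c : ℝ} (hf : ∀ᵐ x ∂m, x ∈ B → f x = c) (v w : M) :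
    ∀ᵐ x ∂m, x ∈ B → pnorm (w - f • v) x = pnorm (w - c • v) x := by
  have e : Linfty.chi m B hB * f = Linfty.chi m B hB * (c • (1 : Linfty m)) := by
    apply Lp.ext
    filter_upwards [hf, Linfty.coeFn_mul (Linfty.chi m B hB) f,
      Linfty.coeFn_mul (Linfty.chi m B hB) (c • (1 : Linfty m)), Linfty.coeFn_chi (m := m) B hB,
      Lp.coeFn_smul c (1 : Linfty m), Linfty.coeFn_one (m := m)] with x h1 h2 h3 h4 h5 h6
    rw [h2, h3, h4, h5, Pi.smul_apply, h6]
    by_cases hx : x ∈ B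
    · simp [hx, h1 hx]
    · simp [hx]
  refine hM.pnorm_eq_of_chi_smul_eq hB ?_
  rw [← hM.const_smul, smul_sub, smul_sub, ← mul_smul, e, mul_smul]

end IsLpNormedModule

end NormedModule

/-! ### Null sets and the chain rule in the cotangent module. -/

namespace DStructure

variable {X : Type*} [MetricSpace X] [MeasurableSpace X] {p : ℝ≥0∞} {m : Measure X}
  (D : DStructure p m) {M : Type*} [NormedAddCommGroup M] [NormedSpace ℝ M] [Module (Linfty m) M]
  {pnorm : M → (X →ₘ[m] ℝ≥0∞)} {d : D.sobolevClass →ₗ[ℝ] M}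

theorem chi_preimage_smul_eq_zero (hp : 1 < p)
    (hball : ∀ (x : X) (r : ℝ), m (Metric.ball x r) < ∞) (hD : D.IsPointwiseLocal)
    (hM : D.IsCotangentModule M pnorm d) (u : D.sobolevClass) {N : Set ℝ} (hN : MeasurableSet N)
    (hN0 : volume N = 0) :
    Linfty.chi m ((u : X →ₘ[m] ℝ) ⁻¹' N) ((u : X →ₘ[m] ℝ).measurable hN) • d u = 0 := by
  refine hM.eq_zero_of_ae ?_
  filter_upwards [hM.pnorm_smul (Linfty.chi m _ ((u : X →ₘ[m] ℝ).measurable hN)) (d u),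
    Linfty.coeFn_chi (m := m) _ ((u : X →ₘ[m] ℝ).measurable hN),
    D.minimalGrad_eq_zero_of_null hp hball hD u.2 hN hN0] with x h1 h2 h3
  rw [h1, h2, hM.pnorm_d]
  by_cases hx : (u : X →ₘ[m] ℝ) x ∈ N
  · rw [h3 hx, mul_zero]
  · rw [indicator_of_notMem (by exact hx), enorm_zero, zero_mul]

/-- On a fibre where `h` equals `c`, the element becomes `d(φ∘u - c u)`, whose pointwise norm is
estimated by `minimalGrad_comp_sub_smul_le`. There are finitely many fibres. -/
theorem pnorm_d_comp_sub_ofSimple_smul_le (hp : 1 < p)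
    (hball : ∀ (x : X) (r : ℝ), m (Metric.ball x r) < ∞) (hD : D.IsPointwiseLocal)
    (hM : D.IsCotangentModule M pnorm d) (u : D.sobolevClass) {φ : ℝ → ℝ} {K : ℝ≥0}
    (hφ : LipschitzWith K φ)
    (hφu : AEEqFun.comp φ hφ.continuous (u : X →ₘ[m] ℝ) ∈ D.sobolevClass) {f : X → ℝ}
    (hf : ∀ᵐ x ∂m, DifferentiableAt ℝ φ ((u : X →ₘ[m] ℝ) x) →
      f x = deriv φ ((u : X →ₘ[m] ℝ) x)) (h : SimpleFunc X ℝ) :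
    ∀ᵐ x ∂m, pnorm (d ⟨_, hφu⟩ - (Linfty.ofSimple h : Linfty m) • d u) x ≤
      ‖f x - h x‖ₑ * pnorm (d u) x := by
  have key : ∀ c ∈ h.range, ∀ᵐ x ∂m, x ∈ h ⁻¹' {c} →
      pnorm (d ⟨_, hφu⟩ - (Linfty.ofSimple h : Linfty m) • d u) x ≤
        ‖f x - h x‖ₑ * pnorm (d u) x := by
    intro c _
    have hc : ∀ᵐ x ∂m, x ∈ h ⁻¹' {c} → (Linfty.ofSimple h : Linfty m) x = c := by
      filter_upwards [Linfty.coeFn_ofSimple (m := m) h] with x h1 hx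
      rw [h1]; exact hx
    filter_upwards [hM.pnorm_sub_smul_eq (h.measurableSet_fiber c) hc (d u) (d ⟨_, hφu⟩),
      D.minimalGrad_comp_sub_smul_le hp hball hD u.2 hφ hf c] with x h1 h2 hx
    rw [h1 hx, ← map_smul, ← map_sub, hM.pnorm_d, hM.pnorm_d, show h x = c from hx]
    exact h2
  filter_upwards [(Filter.eventually_all_finset h.range).2 key] with x hx
  exact hx _ (h.mem_range_self x) rfl

/-- Both `d(φ∘u)` and `f du` lie within `‖f - h‖ ‖du‖` of `h du`, for every simple `h`; density of
simple functions in `L^∞` forces them to agree. -/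
theorem d_comp_eq_smul (hp : 1 < p)
    (hball : ∀ (x : X) (r : ℝ), m (Metric.ball x r) < ∞) (hD : D.IsPointwiseLocal)
    (hM : D.IsCotangentModule M pnorm d) (u : D.sobolevClass) {φ : ℝ → ℝ} {K : ℝ≥0}
    (hφ : LipschitzWith K φ)
    (hφu : AEEqFun.comp φ hφ.continuous (u : X →ₘ[m] ℝ) ∈ D.sobolevClass) (f : Linfty m)
    (hf : ∀ᵐ x ∂m, DifferentiableAt ℝ φ ((u : X →ₘ[m] ℝ) x) →
      f x = deriv φ ((u : X →ₘ[m] ℝ) x)) :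
    d ⟨_, hφu⟩ = f • d u := by
  have key : ∀ h : SimpleFunc X ℝ,
      ‖d ⟨_, hφu⟩ - f • d u‖ ≤ 2 * ‖d u‖ * dist f (Linfty.ofSimple h) := by
    intro h
    have h1 : ‖d ⟨_, hφu⟩ - (Linfty.ofSimple h : Linfty m) • d u‖
        ≤ ‖f - Linfty.ofSimple h‖ * ‖d u‖ := by
      refine hM.norm_le_of_ae_le (C := ‖f - Linfty.ofSimple h‖₊) ?_
      filter_upwards [D.pnorm_d_comp_sub_ofSimple_smul_le hp hball hD hM u hφ hφu hf h,
        Linfty.ae_enorm_le (f - Linfty.ofSimple h), Lp.coeFn_sub f (Linfty.ofSimple h),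
        Linfty.coeFn_ofSimple (m := m) h] with x a1 a2 a3 a4
      rw [a3, Pi.sub_apply, a4] at a2
      exact a1.trans (by gcongr; exact a2)
    have h2 := hM.norm_smul_le' (Linfty.ofSimple h - f) (d u)
    rw [sub_smul, norm_sub_rev (Linfty.ofSimple h)] at h2
    have h3 := norm_add_le (d ⟨_, hφu⟩ - (Linfty.ofSimple h : Linfty m) • d u)
      ((Linfty.ofSimple h : Linfty m) • d u - f • d u)
    rw [sub_add_sub_cancel] at h3
    rw [dist_eq_norm]
    linarith
  rw [← sub_eq_zero, ← norm_le_zero_iff]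
  refine le_of_forall_pos_le_add fun ε hε => ?_
  obtain ⟨_, ⟨h, rfl⟩, hh⟩ := Metric.mem_closure_iff.1 (Linfty.denseRange_ofSimple f)
    -- The summand `1` covers the case `du = 0`.
    (ε / (2 * ‖d u‖ + 1)) (by positivity)
  rw [lt_div_iff₀ (by positivity)] at hh
  have := key h
  have := dist_nonneg (x := f) (y := Linfty.ofSimple h)
  linarith

end DStructure

/-! ### Squares, polarization and the Leibniz rule. -/

/-- The square of the truncation of `t` to `[-C, C]`. -/
noncomputable def truncSq (C : ℝ≥0) (t : ℝ) : ℝ := max (-(C : ℝ)) (min (C : ℝ) t) ^ 2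

/-- Factor the difference of squares: the sum of two truncated values is at most `2C` in size, and
truncation is `1`-Lipschitz. The square itself is not globally Lipschitz, so the chain rule needs
the truncation. -/
theorem lipschitzWith_truncSq (C : ℝ≥0) : LipschitzWith (2 * C) (truncSq C) := by
  have hT : LipschitzWith 1 fun t : ℝ => max (-(C : ℝ)) (min C t) :=
    (LipschitzWith.id.const_min (C : ℝ)).const_max _
  have hb : ∀ t : ℝ, |max (-(C : ℝ)) (min C t)| ≤ C := fun t =>
    abs_le.2 ⟨le_max_left _ _, max_le (by linarith [C.coe_nonneg]) (min_le_left _ _)⟩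
  refine LipschitzWith.of_dist_le_mul fun s t => ?_
  have h := hT.dist_le_mul s t
  rw [NNReal.coe_one, one_mul, Real.dist_eq] at h
  rw [Real.dist_eq, truncSq, truncSq, sq_sub_sq, abs_mul, NNReal.coe_mul, NNReal.coe_ofNat]
  refine mul_le_mul ?_ h (abs_nonneg _) (by positivity)
  linarith [abs_add_le (max (-(C : ℝ)) (min C s)) (max (-(C : ℝ)) (min C t)), hb s, hb t]

theorem truncSq_of_abs_le {C : ℝ≥0} {t : ℝ} (ht : |t| ≤ C) : truncSq C t = t ^ 2 := by
  rw [truncSq, min_eq_right (abs_le.1 ht).2, max_eq_right (abs_le.1 ht).1]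

/-- Strictness makes the truncation inactive in a whole neighbourhood of `t`. -/
theorem deriv_truncSq {C : ℝ≥0} {t : ℝ} (ht : |t| < C) : deriv (truncSq C) t = t + t := by
  have h : truncSq C =ᶠ[𝓝 t] fun s => s ^ 2 := by
    filter_upwards [continuous_abs.continuousAt.eventually_lt continuousAt_const ht] with s hs
    exact truncSq_of_abs_le hs.le
  rw [h.deriv_eq, deriv_pow_field]
  norm_num; ring

theorem mul_mem_Linfty {X : Type*} [MeasurableSpace X] {m : Measure X} {u v : X →ₘ[m] ℝ}
    (hu : u ∈ Linfty m) (hv : v ∈ Linfty m) : u * v ∈ Linfty m := by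
  have h : ((⟨u, hu⟩ * ⟨v, hv⟩ : Linfty m) : X →ₘ[m] ℝ) = u * v := by
    apply AEEqFun.ext
    filter_upwards [Linfty.coeFn_mul ⟨u, hu⟩ ⟨v, hv⟩, AEEqFun.coeFn_mul u v] with x h1 h2
    rw [h1, h2]; rfl
  exact h ▸ SetLike.coe_mem _

theorem add_mul_self_sub_eq_two_smul {X : Type*} [MeasurableSpace X] {m : Measure X}
    (u v : X →ₘ[m] ℝ) : (u + v) * (u + v) - u * u - v * v = (2 : ℝ) • (u * v) := by
  induction u, v using AEEqFun.induction_on₂ with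
  | _ f hf g hg =>
    change AEEqFun.mk ((f + g) * (f + g) - f * f - g * g)
      ((((hf.add hg).mul (hf.add hg)).sub (hf.mul hf)).sub (hg.mul hg)) =
        AEEqFun.mk ((2 : ℝ) • (f * g)) ((hf.mul hg).const_smul 2)
    congr 1
    funext x
    simp only [Pi.sub_apply, Pi.mul_apply, Pi.add_apply, Pi.smul_apply, smul_eq_mul]
    ring

namespace DStructure

variable {X : Type*} [MetricSpace X] [MeasurableSpace X] {p : ℝ≥0∞} {m : Measure X}
  (D : DStructure p m) {M : Type*} [NormedAddCommGroup M] [NormedSpace ℝ M] [Module (Linfty m) M]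
  {pnorm : M → (X →ₘ[m] ℝ≥0∞)} {d : D.sobolevClass →ₗ[ℝ] M}

theorem exists_d_mul_self (hp : 1 < p)
    (hball : ∀ (x : X) (r : ℝ), m (Metric.ball x r) < ∞) (hD : D.IsPointwiseLocal)
    (hM : D.IsCotangentModule M pnorm d) (u : D.sobolevClass)
    (hu : (u : X →ₘ[m] ℝ) ∈ Linfty m) :
    ∃ h : (u : X →ₘ[m] ℝ) * (u : X →ₘ[m] ℝ) ∈ D.sobolevClass,
      d ⟨_, h⟩ = ((⟨u, hu⟩ : Linfty m) + ⟨u, hu⟩) • d u := by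
  let f : Linfty m := ⟨u, hu⟩
  -- The level exceeds the sup norm by `1`, so that `|u|` is a.e. strictly below it and
  -- `deriv_truncSq` applies.
  have hφ := lipschitzWith_truncSq (‖f‖₊ + 1)
  have hb : ∀ᵐ x ∂m, |(u : X →ₘ[m] ℝ) x| < (‖f‖₊ + 1 : ℝ≥0) := by
    filter_upwards [Linfty.ae_enorm_le f] with x hx
    rw [enorm_eq_nnnorm, enorm_eq_nnnorm, ENNReal.coe_le_coe] at hx
    exact NNReal.coe_lt_coe.2 (hx.trans_lt (lt_add_one ‖f‖₊))
  have e : AEEqFun.comp _ hφ.continuous (u : X →ₘ[m] ℝ) = (u : X →ₘ[m] ℝ) * u := by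
    apply AEEqFun.ext
    filter_upwards [AEEqFun.coeFn_comp _ hφ.continuous (u : X →ₘ[m] ℝ),
      AEEqFun.coeFn_mul (u : X →ₘ[m] ℝ) u, hb] with x h1 h2 h3
    rw [h1, h2, Function.comp_apply, truncSq_of_abs_le h3.le, Pi.mul_apply, sq]
  have hmem := D.comp_mem_sobolevClass hp hball u.2 hφ
  have hd := D.d_comp_eq_smul hp hball hD hM u hφ hmem (f + f) (by
    filter_upwards [hb, Lp.coeFn_add f f] with x h1 h2 _
    rw [h2, deriv_truncSq h1]; rfl)
  refine ⟨e ▸ hmem, ?_⟩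
  rw [← hd]
  congr 1
  exact Subtype.ext e.symm

/-- Polarization: twice `u v` is `(u + v)² - u² - v²`, and all three squares are covered by
`exists_d_mul_self`. -/
theorem exists_d_mul (hp : 1 < p)
    (hball : ∀ (x : X) (r : ℝ), m (Metric.ball x r) < ∞) (hD : D.IsPointwiseLocal)
    (hM : D.IsCotangentModule M pnorm d) (u v : D.sobolevClass)
    (hu : (u : X →ₘ[m] ℝ) ∈ Linfty m) (hv : (v : X →ₘ[m] ℝ) ∈ Linfty m) :
    ∃ h : (u : X →ₘ[m] ℝ) * (v : X →ₘ[m] ℝ) ∈ D.sobolevClass,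
      d ⟨_, h⟩ = (⟨u, hu⟩ : Linfty m) • d v + (⟨v, hv⟩ : Linfty m) • d u := by
  obtain ⟨h1, e1⟩ := D.exists_d_mul_self hp hball hD hM u hu
  obtain ⟨h2, e2⟩ := D.exists_d_mul_self hp hball hD hM v hv
  obtain ⟨h3, e3⟩ := D.exists_d_mul_self hp hball hD hM (u + v) (add_mem hu hv)
  have e : (u : X →ₘ[m] ℝ) * v = ((1 / 2 : ℝ) • (⟨_, h3⟩ - ⟨_, h1⟩ - ⟨_, h2⟩ : D.sobolevClass) :
      D.sobolevClass) := by
    simp only [Submodule.coe_smul, Submodule.coe_sub, Submodule.coe_add]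
    rw [add_mul_self_sub_eq_two_smul, smul_smul]
    norm_num
  have hmem : (u : X →ₘ[m] ℝ) * v ∈ D.sobolevClass := e ▸ SetLike.coe_mem _
  refine ⟨hmem, ?_⟩
  have e' : (⟨_, hmem⟩ : D.sobolevClass) = (1 / 2 : ℝ) • (⟨_, h3⟩ - ⟨_, h1⟩ - ⟨_, h2⟩) :=
    Subtype.ext e
  have e4 : (⟨((u + v : D.sobolevClass) : X →ₘ[m] ℝ), add_mem hu hv⟩ : Linfty m)
      = ⟨u, hu⟩ + ⟨v, hv⟩ := rfl
  rw [e', map_smul, map_sub, map_sub, e1, e2, e3, e4, map_add]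
  -- Subtracting `2u du` and `2v dv` leaves twice the cross terms; the factor `1 / 2` then cancels.
  have e5 : ((⟨u, hu⟩ + ⟨v, hv⟩ + (⟨u, hu⟩ + ⟨v, hv⟩) : Linfty m)) • (d u + d v) -
      ((⟨u, hu⟩ : Linfty m) + ⟨u, hu⟩) • d u - ((⟨v, hv⟩ : Linfty m) + ⟨v, hv⟩) • d v =
      (2 : ℝ) • ((⟨u, hu⟩ : Linfty m) • d v + (⟨v, hv⟩ : Linfty m) • d u) := by
    rw [two_smul]
    simp only [add_smul, smul_add]
    abel
  rw [e5, smul_smul]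
  norm_num

end DStructure

end AxiomaticSobolev


theorem proposition3p4
    {X : Type*} [MetricSpace X] [CompleteSpace X] [TopologicalSpace.SeparableSpace X]
    [MeasurableSpace X] [BorelSpace X]
    (m : Measure X) (hm : m ≠ 0) (hball : ∀ (x : X) (r : ℝ), m (Metric.ball x r) < ∞)
    (p : ℝ≥0∞) (hp : 1 < p) (hp' : p < ∞)
    (D : DStructure p m) (hD : D.IsPointwiseLocal)
    -- the cotangent module, its pointwise norm, and the differential
    {M : Type*} [NormedAddCommGroup M] [NormedSpace ℝ M] [Module (Linfty m) M]
    (pnorm : M → (X →ₘ[m] ℝ≥0∞)) (d : D.sobolevClass →ₗ[ℝ] M)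
    (hM : D.IsCotangentModule M pnorm d) :
    -- vanishing of `du` on the preimages of null sets
    (∀ (u : D.sobolevClass) (N : Set ℝ) (hN : MeasurableSet N), volume N = 0 →
      Linfty.chi m ((u : X →ₘ[m] ℝ) ⁻¹' N) ((u : X →ₘ[m] ℝ).measurable hN) • d u = 0) ∧
    -- chain rule; `φ' ∘ u` is any `f ∈ L^∞(m)` equal to it where `φ` is differentiable at `u(x)`
    (∀ (u : D.sobolevClass) (φ : ℝ → ℝ) (K : ℝ≥0) (hφ : LipschitzWith K φ),
      ∃ h : AEEqFun.comp φ hφ.continuous (u : X →ₘ[m] ℝ) ∈ D.sobolevClass,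
        (∃ f : Linfty m, f =ᵐ[m] fun x => deriv φ ((u : X →ₘ[m] ℝ) x)) ∧
        ∀ f : Linfty m, (∀ᵐ x ∂m, DifferentiableAt ℝ φ ((u : X →ₘ[m] ℝ) x) →
            f x = deriv φ ((u : X →ₘ[m] ℝ) x)) →
          d ⟨AEEqFun.comp φ hφ.continuous (u : X →ₘ[m] ℝ), h⟩ = f • d u) ∧
    -- Leibniz rule
    (∀ (u v : D.sobolevClass) (hu : (u : X →ₘ[m] ℝ) ∈ Linfty m)
      (hv : (v : X →ₘ[m] ℝ) ∈ Linfty m),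
      ∃ (h : (u : X →ₘ[m] ℝ) * (v : X →ₘ[m] ℝ) ∈ D.sobolevClass)
        (_ : (u : X →ₘ[m] ℝ) * (v : X →ₘ[m] ℝ) ∈ Linfty m),
        d ⟨(u : X →ₘ[m] ℝ) * (v : X →ₘ[m] ℝ), h⟩ =
          (⟨u, hu⟩ : Linfty m) • d v + (⟨v, hv⟩ : Linfty m) • d u) := by
  refine ⟨fun u N hN hN0 => D.chi_preimage_smul_eq_zero hp hball hD hM u hN hN0,
    fun u φ K hφ => ?_, fun u v hu hv => ?_⟩
  · have h := D.comp_mem_sobolevClass hp hball u.2 hφ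
    exact ⟨h, exists_linfty_eq_deriv _ hφ, D.d_comp_eq_smul hp hball hD hM u hφ h⟩
  · obtain ⟨h, e⟩ := D.exists_d_mul hp hball hD hM u v hu hv
    exact ⟨h, mul_mem_Linfty hu hv, e⟩
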